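/- A unitrivalent diagram on $k$ colors is a finite non-empty graph (possibly disconnected) all of whose vertices have valence 1 or 3, with a cyclic order of the three half-edges at each trivalent vertex and with a color from $\{1,\dots,k\}$ at each univalent vertex; diagrams are considered up to isomorphism. Let $B^h(k)$ be the complex vector space generated by these diagrams modulo the following relations: (1) (AS) interchanging two of the edges at a trivalent vertex changes the sign of the diagram; (2) (IHX) if an edge joins two different trivalent vertices, with cyclic orders $(e,a,b)$ and $(\bar e,c,d)$, where $e,\bar e$ are the two halves of this edge, then the sum of the three diagrams obtained by cyclically permuting what is attached at $a,b,c$ is zero; (3) (link relation) for each diagram with a distinguished univalent vertex $s$, of color $i$ say, the sum over all other univalent vertices $x$ of color $i$ of the diagrams obtained by attaching the end at $s$ to the edge ending at $x$, next to $x$, is zero (the end formerly at $s$, the end formerly at $x$ and a new edge leading to a univalent vertex of color $i$ meet, in this cyclic order, in a new trivalent vertex); (4) a diagram containing a loop (a cycle of any length) is zero; (5) a diagram with a connected component that has two univalent vertices of the same color is zero. The degree of a connected component is one half of the number of its vertices. Theorem. If a diagram $D$ on $5$ colors has a connected component of degree 2, then $D=0$ in $B^h(5)$. -/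

import Mathlib

/-- A unitrivalent diagram with univalent vertices coloured by `Fin k`: a finite nonempty graph,
possibly disconnected, possibly with multiple edges and self-loops, all of whose vertices are
univalent or trivalent, with a cyclic order of the three half-edges at each trivalent vertex and
a colour at each univalent vertex.

It is encoded by its half-edges. The edges are the orbits of the fixed-point free involution
`inv`. The vertices are the orbits of `next`, whose cube is the identity: a fixed point of `next`
is (the half-edge at) a univalent vertex, and an orbit of size three is a trivalent vertex with
its cyclic order. -/
structure UTDiagram (k : ℕ) where
  /-- The half-edges. -/
  HalfEdge : Type
  finite : Finite HalfEdge
  nonempty : Nonempty HalfEdge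
  /-- The other half of the same edge. -/
  inv : Equiv.Perm HalfEdge
  inv_inv : ∀ h, inv (inv h) = h
  inv_ne : ∀ h, inv h ≠ h
  /-- The next half-edge at the same vertex. -/
  next : Equiv.Perm HalfEdge
  next_next_next : ∀ h, next (next (next h)) = h
  /-- The colours of the univalent vertices. -/
  color : ∀ h, next h = h → Fin k

namespace UTDiagram

attribute [instance] UTDiagram.finite UTDiagram.nonempty

noncomputable instance {k : ℕ} (D : UTDiagram k) : Fintype D.HalfEdge := Fintype.ofFinite _

/-- Two diagrams are isomorphic if there is a bijection of their half-edges that respects the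
edges, the vertices with their cyclic orders, and the colours. -/
def Isomorphic {k : ℕ} (D E : UTDiagram k) : Prop :=
  ∃ f : D.HalfEdge ≃ E.HalfEdge,
    (∀ h, f (D.inv h) = E.inv (f h)) ∧
    (∀ h, f (D.next h) = E.next (f h)) ∧
    (∀ h (hD : D.next h = h) (hE : E.next (f h) = f h), E.color (f h) hE = D.color h hD)

/-- Two half-edges lie in the same connected component of the diagram. -/
def SameComponent {k : ℕ} (D : UTDiagram k) : D.HalfEdge → D.HalfEdge → Prop :=
  Relation.EqvGen fun x y => y = D.inv x ∨ y = D.next x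

/-- The vertices of a diagram: the orbits of `next`. -/
def Vertex {k : ℕ} (D : UTDiagram k) : Type :=
  Quotient (Equiv.Perm.SameCycle.setoid D.next)

/-- The vertex at which a half-edge is attached. -/
def vertexOf {k : ℕ} (D : UTDiagram k) (h : D.HalfEdge) : D.Vertex :=
  Quotient.mk (Equiv.Perm.SameCycle.setoid D.next) h

/-- The degree of the connected component that contains the half-edge `h`: one half of the number
of its vertices. -/
noncomputable def componentDegree {k : ℕ} (D : UTDiagram k) (h : D.HalfEdge) : ℚ :=
  (Set.ncard (D.vertexOf '' {x | D.SameComponent h x}) : ℚ) / 2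

/-- One step of a walk without backtracking. A half-edge `x` stands for its edge, traversed from
the vertex of `x` to the vertex of `inv x`; the walk goes on along another half-edge `y` at the
latter vertex. -/
def WalkStep {k : ℕ} (D : UTDiagram k) (x y : D.HalfEdge) : Prop :=
  y ≠ D.inv x ∧ (y = D.next (D.inv x) ∨ y = D.next (D.next (D.inv x)))

/-- The underlying graph contains a loop (a cycle of any length, self-loops included): there is a
closed walk without backtracking. -/
def HasLoop {k : ℕ} (D : UTDiagram k) : Prop :=
  ∃ x, Relation.TransGen D.WalkStep x x

/-- Some connected component has two different univalent vertices of the same colour. -/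
def HasRepeatedColor {k : ℕ} (D : UTDiagram k) : Prop :=
  ∃ (x y : D.HalfEdge) (hx : D.next x = x) (hy : D.next y = y),
    x ≠ y ∧ D.SameComponent x y ∧ D.color x hx = D.color y hy

/-- The diagram with the same vertices in which whatever was attached at the half-edge `x` is now
attached at the half-edge `p x`. -/
def rewire {k : ℕ} (D : UTDiagram k) (p : Equiv.Perm D.HalfEdge) : UTDiagram k where
  HalfEdge := D.HalfEdge
  finite := D.finite
  nonempty := D.nonempty
  inv := p * D.inv * p⁻¹
  inv_inv h := by simp [D.inv_inv]
  inv_ne h := by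
    intro e
    apply D.inv_ne (p⁻¹ h)
    apply p.injective
    simpa using e
  next := D.next
  next_next_next := D.next_next_next
  color := D.color

open Classical in
/-- The permutation of half-edges after the univalent vertices `s` and `x` have been merged into a
trivalent vertex `s → x → inr true → s`, from which a new edge, with halves `inr true` and
`inr false`, leads to a new univalent vertex. -/
noncomputable def attachNext {k : ℕ} (D : UTDiagram k) (s x : D.HalfEdge) :
    Equiv.Perm (D.HalfEdge ⊕ Bool) :=
  Equiv.sumCongr D.next (Equiv.refl Bool) * Equiv.swap (Sum.inl s) (Sum.inl x) *
    Equiv.swap (Sum.inl x) (Sum.inr true)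

theorem attachNext_s {k : ℕ} (D : UTDiagram k) {s x : D.HalfEdge}
    (hx : D.next x = x) (hne : x ≠ s) : D.attachNext s x (Sum.inl s) = Sum.inl x := by
  classical
  have h1 : (Sum.inl s : D.HalfEdge ⊕ Bool) ≠ Sum.inl x := fun h => hne (Sum.inl.inj h).symm
  simp [attachNext, Equiv.swap_apply_of_ne_of_ne h1, hx]

theorem attachNext_x {k : ℕ} (D : UTDiagram k) (s x : D.HalfEdge) :
    D.attachNext s x (Sum.inl x) = Sum.inr true := by
  classical
  have h1 : (Sum.inr true : D.HalfEdge ⊕ Bool) ≠ Sum.inl s := by simp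
  have h2 : (Sum.inr true : D.HalfEdge ⊕ Bool) ≠ Sum.inl x := by simp
  simp [attachNext, Equiv.swap_apply_of_ne_of_ne h1 h2]

theorem attachNext_true {k : ℕ} (D : UTDiagram k) {s x : D.HalfEdge}
    (hs : D.next s = s) : D.attachNext s x (Sum.inr true) = Sum.inl s := by
  classical
  simp [attachNext, hs]

theorem attachNext_false {k : ℕ} (D : UTDiagram k) (s x : D.HalfEdge) :
    D.attachNext s x (Sum.inr false) = Sum.inr false := by
  classical
  have h1 : (Sum.inr false : D.HalfEdge ⊕ Bool) ≠ Sum.inl s := by simp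
  have h2 : (Sum.inr false : D.HalfEdge ⊕ Bool) ≠ Sum.inl x := by simp
  have h3 : (Sum.inr false : D.HalfEdge ⊕ Bool) ≠ Sum.inr true := by simp
  simp [attachNext, Equiv.swap_apply_of_ne_of_ne h1 h2, Equiv.swap_apply_of_ne_of_ne h2 h3]

theorem attachNext_of_ne {k : ℕ} (D : UTDiagram k) {s x h : D.HalfEdge}
    (hs : h ≠ s) (hx : h ≠ x) : D.attachNext s x (Sum.inl h) = Sum.inl (D.next h) := by
  classical
  have h1 : (Sum.inl h : D.HalfEdge ⊕ Bool) ≠ Sum.inl s := fun e => hs (Sum.inl.inj e)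
  have h2 : (Sum.inl h : D.HalfEdge ⊕ Bool) ≠ Sum.inl x := fun e => hx (Sum.inl.inj e)
  have h3 : (Sum.inl h : D.HalfEdge ⊕ Bool) ≠ Sum.inr true := by simp
  simp [attachNext, Equiv.swap_apply_of_ne_of_ne h1 h2, Equiv.swap_apply_of_ne_of_ne h2 h3]

/-- The diagram obtained from `D` by attaching the end of the univalent vertex `s` to the edge
that ends at another univalent vertex `x` of the same colour, just before `x`: the ends at `s` and
`x` now meet in a trivalent vertex, whose third edge leads to a univalent vertex with the colour
of `x`. The cyclic order at the new vertex is the same for all `x`: the end that was at `s`, the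
end that was at `x`, the new edge. -/
noncomputable def attach {k : ℕ} (D : UTDiagram k) (s x : D.HalfEdge)
    (hs : D.next s = s) (hx : D.next x = x) (hne : x ≠ s) : UTDiagram k where
  HalfEdge := D.HalfEdge ⊕ Bool
  finite := inferInstance
  nonempty := inferInstance
  inv := Equiv.sumCongr D.inv Equiv.boolNot
  inv_inv h := by rcases h with h | b <;> simp [D.inv_inv]
  inv_ne h := by
    rcases h with h | b
    · simpa using D.inv_ne h
    · cases b <;> simp
  next := D.attachNext s x
  next_next_next h := by
    rcases h with h | b
    · by_cases h1 : h = s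
      · subst h1
        rw [D.attachNext_s hx hne, D.attachNext_x, D.attachNext_true hs]
      · by_cases h2 : h = x
        · subst h2
          rw [D.attachNext_x, D.attachNext_true hs, D.attachNext_s hx hne]
        · have aux : ∀ y z : D.HalfEdge, y ≠ z → D.next z = z → D.next y ≠ z := by
            intro y z hyz hz e
            exact hyz (D.next.injective (e.trans hz.symm))
          rw [D.attachNext_of_ne h1 h2,
            D.attachNext_of_ne (aux _ _ h1 hs) (aux _ _ h2 hx),
            D.attachNext_of_ne (aux _ _ (aux _ _ h1 hs) hs) (aux _ _ (aux _ _ h2 hx) hx),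
            D.next_next_next]
    · cases b
      · rw [D.attachNext_false, D.attachNext_false, D.attachNext_false]
      · rw [D.attachNext_true hs, D.attachNext_s hx hne, D.attachNext_x]
  color h hh :=
    match h, hh with
    | Sum.inl h, hh => D.color h (by
        by_cases h1 : h = s
        · rw [h1, hs]
        · by_cases h2 : h = x
          · rw [h2, hx]
          · rw [D.attachNext_of_ne h1 h2] at hh
            exact Sum.inl.inj hh)
    | Sum.inr _, _ => D.color x hx

open Classical in
/-- The generators of the relations that define the space of unitrivalent diagrams for link
homotopy, as formal linear combinations of diagrams. -/
inductive HomotopyRelator (k : ℕ) : (UTDiagram k →₀ ℂ) → Prop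
  /-- Diagrams are considered up to isomorphism. -/
  | iso (D E : UTDiagram k) (hDE : D.Isomorphic E) :
      HomotopyRelator k (Finsupp.single D 1 - Finsupp.single E 1)
  /-- AS: interchanging two of the three edges at a trivalent vertex changes the sign. -/
  | antisymmetry (D : UTDiagram k) (h : D.HalfEdge) (hh : D.next h ≠ h) :
      HomotopyRelator k
        (Finsupp.single D 1 +
          Finsupp.single (D.rewire (Equiv.swap (D.next h) (D.next (D.next h)))) 1)
  /-- IHX, in its cyclic form: if an edge with halves `h` and `inv h` joins the two different
  trivalent vertices with cyclic orders `(h, a, b)` and `(inv h, c, d)`, then the sum over the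
  three cyclic permutations of the ends attached at `a`, `b`, `c` vanishes. -/
  | ihx (D : UTDiagram k) (h a b c : D.HalfEdge)
      (ha : a = D.next h) (hb : b = D.next a) (hc : c = D.next (D.inv h))
      (h_tri : D.next h ≠ h) (h_tri' : D.next (D.inv h) ≠ D.inv h)
      (h_ne : D.vertexOf h ≠ D.vertexOf (D.inv h)) :
      HomotopyRelator k
        (Finsupp.single D 1 +
          Finsupp.single (D.rewire (Equiv.swap a b * Equiv.swap b c)) 1 +
          Finsupp.single (D.rewire ((Equiv.swap a b * Equiv.swap b c) ^ 2)) 1)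
  /-- The link relation: the sum of the results of attaching the end at the univalent vertex `s`
  to all the other univalent vertices of the same colour vanishes. -/
  | link (D : UTDiagram k) (s : D.HalfEdge) (hs : D.next s = s) :
      HomotopyRelator k
        (∑ x : {x : D.HalfEdge // x ≠ s ∧ ∃ hx : D.next x = x, D.color x hx = D.color s hs},
          Finsupp.single (D.attach s x.1 hs x.2.2.1 x.2.1) 1)
  /-- A diagram with a loop is trivial. -/
  | loop (D : UTDiagram k) (hD : D.HasLoop) : HomotopyRelator k (Finsupp.single D 1)
  /-- A diagram with two univalent vertices of the same colour on one connected component is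
  trivial. -/
  | repeatedColor (D : UTDiagram k) (hD : D.HasRepeatedColor) :
      HomotopyRelator k (Finsupp.single D 1)

end UTDiagram

/-- The space `B^h(k)` of unitrivalent diagrams for homotopy of links with `k` components. -/
abbrev LinkHomotopySpace (k : ℕ) : Type 1 :=
  (UTDiagram k →₀ ℂ) ⧸ Submodule.span ℂ {r | UTDiagram.HomotopyRelator k r}

/-- The element of `B^h(k)` represented by a diagram. -/
noncomputable def UTDiagram.toSpace {k : ℕ} (D : UTDiagram k) : LinkHomotopySpace k :=
  Submodule.Quotient.mk (Finsupp.single D 1)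

/-! In fact every diagram on five colors with a trivalent vertex vanishes. Degree 2 matters only
because a component without trivalent vertices is a chord, of degree at most one. Modulo loops and
repeated colors all components are trees with at most five leaves, and trees with five, four and
three leaves are eliminated in this order.

Fix a linear functional `φ` and a union `M` of components none of which is a chord. For a tree `T`,
the values of `φ` on `T`, `M` and any collection of chords are packed into an exponential generating
function `gen M φ T`, whose variables count chords by the colors of their ends. Thanks to the
factorials, removing one of several equal chords corresponds to multiplication by a variable. The
link relation at a leaf of color `i` of a tree `t` therefore becomes `∑ m, x i m * gen (t_m) = 0`,
where `t_m` is `t` grafted onto a chord with colors `i`, `m` (`sum_chordVar_mul_gen_graft`).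
Attaching to `M` instead creates a loop or a tree with more leaves than `t_m`, which is already
known to vanish.

This is a linear system over a domain of power series, and it remains to see that it is
nondegenerate. For five leaves a single term survives. For four leaves the link relations show that
`x a b * x c d * g a b c d` is invariant under cyclic permutations of `a`, `b`, `c`, and IHX then
forces it to vanish (`quad_system`). For three leaves, eliminating one unknown at a time leaves a 3
by 3 system with nonzero determinant (`tripod_system`). Since functionals separate points, the
diagrams themselves are zero. -/

namespace UTDiagram

variable {k : ℕ}

/-! ### Walks without backtracking in a forest, and counting leaves. -/

section Walks

variable {D : UTDiagram k}

theorem next_eq_self_of_next_next {x : D.HalfEdge} (h : D.next (D.next x) = D.next x) :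
    D.next x = x :=
  D.next.injective h

theorem next_next_ne_self {x : D.HalfEdge} (h : D.next x ≠ x) : D.next (D.next x) ≠ x := by
  intro e
  have := D.next_next_next x
  rw [e] at this
  exact h this

theorem next_next_ne_next {x : D.HalfEdge} (h : D.next x ≠ x) :
    D.next (D.next x) ≠ D.next x :=
  fun e => h (D.next.injective e)

theorem walkStep_next {x : D.HalfEdge} (h : D.next (D.inv x) ≠ D.inv x) :
    D.WalkStep x (D.next (D.inv x)) :=
  ⟨h, Or.inl rfl⟩

theorem walkStep_next_next {x : D.HalfEdge} (h : D.next (D.inv x) ≠ D.inv x) :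
    D.WalkStep x (D.next (D.next (D.inv x))) :=
  ⟨next_next_ne_self h, Or.inr rfl⟩

theorem walkStep_inv_next {x : D.HalfEdge} (h : D.next x ≠ x) :
    D.WalkStep (D.inv x) (D.next x) := by
  have := @walkStep_next k D (D.inv x)
  rw [D.inv_inv] at this
  exact this h

theorem walkStep_inv_next_next {x : D.HalfEdge} (h : D.next x ≠ x) :
    D.WalkStep (D.inv x) (D.next (D.next x)) := by
  have := @walkStep_next_next k D (D.inv x)
  rw [D.inv_inv] at this
  exact this h

theorem WalkStep.reverse {x y : D.HalfEdge} (h : D.WalkStep x y) :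
    D.WalkStep (D.inv y) (D.inv x) := by
  obtain ⟨h1, h2⟩ := h
  refine ⟨by rw [D.inv_inv]; exact h1.symm, ?_⟩
  rw [D.inv_inv]
  rcases h2 with h2 | h2
  · right; rw [h2, D.next_next_next]
  · left; rw [h2, D.next_next_next]

/-- Three half-edges meet at the far end of `x`: `inv x`, the outgoing `c`, and `inv d`. If the last
two differ, a walk that arrives along `d` may leave along `c`. -/
theorem WalkStep.turn {x c d : D.HalfEdge} (h1 : D.WalkStep x c) (h2 : D.WalkStep d (D.inv x))
    (hne : c ≠ D.inv d) : D.WalkStep d c := by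
  refine ⟨hne, ?_⟩
  obtain ⟨-, h1⟩ := h1
  obtain ⟨-, h2⟩ := h2
  rcases h1 with h1 | h1 <;> rcases h2 with h2 | h2 <;> rw [h2] at h1
  · exact Or.inr h1
  · rw [D.next_next_next] at h1; exact absurd h1 hne
  · rw [D.next_next_next] at h1; exact absurd h1 hne
  · rw [D.next_next_next] at h1; exact Or.inl h1

theorem reflTransGen_reverse {x y : D.HalfEdge} (h : Relation.ReflTransGen D.WalkStep x y) :
    Relation.ReflTransGen D.WalkStep (D.inv y) (D.inv x) := by
  induction h with
  | refl => exact .refl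
  | tail _ h2 ih => exact Relation.ReflTransGen.head h2.reverse ih

theorem transGen_reverse {x y : D.HalfEdge} (h : Relation.TransGen D.WalkStep x y) :
    Relation.TransGen D.WalkStep (D.inv y) (D.inv x) := by
  induction h with
  | single h => exact .single h.reverse
  | tail _ h2 ih => exact Relation.TransGen.head h2.reverse ih

/-- Absence of loops is irreflexivity of the walk relation, and finiteness does the rest; this
permits induction along walks. -/
theorem walk_wellFounded (hD : ¬ D.HasLoop) :
    WellFounded (fun x y => Relation.TransGen D.WalkStep y x) := by
  have h1 : Std.Irrefl (fun x y : D.HalfEdge => Relation.TransGen D.WalkStep y x) :=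
    ⟨fun x hx => hD ⟨x, hx⟩⟩
  have h2 : IsTrans D.HalfEdge (fun x y : D.HalfEdge => Relation.TransGen D.WalkStep y x) :=
    ⟨fun _ _ _ a b => b.trans a⟩
  exact Finite.wellFounded_of_trans_of_irrefl _

/-- A walk that returns along its first edge has the shape of a lollipop. Strip the common stick
from both ends, by induction along the walk: either the walk closes up to a loop, or it would have
to reverse on a single edge, which is backtracking. -/
theorem not_transGen_inv (hD : ¬ D.HasLoop) (x : D.HalfEdge) :
    ¬ Relation.TransGen D.WalkStep x (D.inv x) := by
  induction x using (walk_wellFounded hD).induction with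
  | _ x ih =>
    intro h
    obtain ⟨c, hxc, hc⟩ := Relation.TransGen.head'_iff.1 h
    rcases Relation.ReflTransGen.cases_tail hc with e | ⟨d, hcd, hd⟩
    · exact hxc.1 e.symm
    · by_cases hne : c = D.inv d
      · have hd' : d = D.inv c := by rw [hne, D.inv_inv]
        rw [hd'] at hcd
        rcases Relation.reflTransGen_iff_eq_or_transGen.1 hcd with e | e
        · exact D.inv_ne c e
        · exact ih c (.single hxc) e
      · exact hD ⟨c, Relation.TransGen.tail' hcd (hxc.turn hd hne)⟩

theorem exists_walk_to_leaf (hD : ¬ D.HasLoop) (x : D.HalfEdge) :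
    ∃ z, Relation.ReflTransGen D.WalkStep x z ∧ D.next (D.inv z) = D.inv z := by
  induction x using (walk_wellFounded hD).induction with
  | _ x ih =>
    by_cases h : D.next (D.inv x) = D.inv x
    · exact ⟨x, .refl, h⟩
    · obtain ⟨z, hz, hz'⟩ := ih _ (.single (walkStep_next h))
      exact ⟨z, .head (walkStep_next h) hz, hz'⟩

theorem sameComponent_inv (x : D.HalfEdge) : D.SameComponent x (D.inv x) :=
  .rel _ _ (Or.inl rfl)

theorem sameComponent_next (x : D.HalfEdge) : D.SameComponent x (D.next x) :=
  .rel _ _ (Or.inr rfl)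

theorem SameComponent.symm {x y : D.HalfEdge} (h : D.SameComponent x y) : D.SameComponent y x :=
  Relation.EqvGen.symm _ _ h

theorem SameComponent.trans {x y z : D.HalfEdge} (h : D.SameComponent x y)
    (h' : D.SameComponent y z) : D.SameComponent x z :=
  Relation.EqvGen.trans _ _ _ h h'

theorem WalkStep.sameComponent {x y : D.HalfEdge} (h : D.WalkStep x y) : D.SameComponent x y := by
  rcases h.2 with e | e <;> rw [e]
  · exact (sameComponent_inv x).trans (sameComponent_next _)
  · exact ((sameComponent_inv x).trans (sameComponent_next _)).trans (sameComponent_next _)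

theorem sameComponent_of_walk {x y : D.HalfEdge} (h : Relation.ReflTransGen D.WalkStep x y) :
    D.SameComponent x y := by
  induction h with
  | refl => exact .refl _
  | tail _ h2 ih => exact ih.trans h2.sameComponent

/-- There is a walk that enters the diagram at the far end of `a` and leaves it along `b`: the two
half-edges point away from each other. -/
def Diverge (D : UTDiagram k) (a b : D.HalfEdge) : Prop :=
  Relation.TransGen D.WalkStep (D.inv a) b

theorem Diverge.symm {a b : D.HalfEdge} (h : D.Diverge a b) : D.Diverge b a := by
  have := transGen_reverse h
  rwa [D.inv_inv] at this

instance : Std.Symm D.Diverge := ⟨fun _ _ h => h.symm⟩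

theorem Diverge.step {a b c : D.HalfEdge} (h : D.Diverge a b) (h' : D.WalkStep b c) :
    D.Diverge a c :=
  Relation.TransGen.tail h h'

theorem Diverge.ne (hD : ¬ D.HasLoop) {a b : D.HalfEdge} (h : D.Diverge a b) : a ≠ b := by
  rintro rfl
  have := not_transGen_inv hD (D.inv a)
  rw [D.inv_inv] at this
  exact this h

/-- If both walks ended with `z`, then running back along the first, across, and out along the
second would lead from `inv z` to `z`. -/
theorem Diverge.walk_ne (hD : ¬ D.HasLoop) {a b z w : D.HalfEdge} (h : D.Diverge a b)
    (hz : Relation.ReflTransGen D.WalkStep a z) (hw : Relation.ReflTransGen D.WalkStep b w) :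
    z ≠ w := by
  rintro rfl
  have := not_transGen_inv hD (D.inv z)
  rw [D.inv_inv] at this
  exact this ((Relation.TransGen.trans_right (reflTransGen_reverse hz) h).trans_left hw)

theorem Diverge.sameComponent {a b : D.HalfEdge} (h : D.Diverge a b) : D.SameComponent a b :=
  (sameComponent_inv a).trans (sameComponent_of_walk h.to_reflTransGen)

/-- Each half-edge continues to a leaf, the leaves are distinct because the half-edges diverge, and
there are more leaves than colors. -/
theorem hasRepeatedColor_of_diverge (hD : ¬ D.HasLoop) (L : List D.HalfEdge)
    (hL : L.Pairwise D.Diverge) (hk : k < L.length) : D.HasRepeatedColor := by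
  choose z hz hz' using exists_walk_to_leaf hD
  have hcard : Fintype.card (Fin k) < Fintype.card (Fin L.length) := by simpa using hk
  obtain ⟨i, j, hij, hc⟩ := Fintype.exists_ne_map_eq_of_card_lt
    (fun i : Fin L.length => D.color (D.inv (z (L.get i))) (hz' _)) hcard
  have hdiv : D.Diverge (L.get i) (L.get j) := by
    rcases lt_or_gt_of_ne hij with h | h
    · exact List.pairwise_iff_get.1 hL i j h
    · exact (List.pairwise_iff_get.1 hL j i h).symm
  refine ⟨_, _, hz' _, hz' _, ?_, ?_, hc⟩
  · exact fun e => hdiv.walk_ne hD (hz _) (hz _) (D.inv.injective e)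
  · exact ((sameComponent_of_walk (hz _)).trans (sameComponent_inv _)).symm.trans
      (hdiv.sameComponent.trans ((sameComponent_of_walk (hz _)).trans (sameComponent_inv _)))

/-- Among as many pairwise diverging half-edges as there are colours all lead to univalent
vertices, unless a colour is repeated. -/
theorem hasRepeatedColor_of_diverge_of_ne (hD : ¬ D.HasLoop) (L : List D.HalfEdge)
    (hL : L.Pairwise D.Diverge) (hk : k ≤ L.length) {a : D.HalfEdge} (ha : a ∈ L)
    (hne : D.next (D.inv a) ≠ D.inv a) : D.HasRepeatedColor := by
  obtain ⟨L', hp⟩ : ∃ L', L.Perm (a :: L') := by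
    classical exact ⟨_, List.perm_cons_erase ha⟩
  have hL' := (hp.pairwise_iff (fun h => Diverge.symm h)).1 hL
  rw [List.pairwise_cons] at hL'
  -- Beyond its far end `a` branches in two; both branches diverge from each other and from the
  -- rest, so the list grows beyond `k`.
  refine hasRepeatedColor_of_diverge hD
    (D.next (D.inv a) :: D.next (D.next (D.inv a)) :: L') ?_ ?_
  · rw [List.pairwise_cons, List.pairwise_cons]
    refine ⟨?_, fun b hb => ?_, hL'.2⟩
    · intro b hb
      rw [List.mem_cons] at hb
      rcases hb with rfl | hb
      · exact .single (walkStep_inv_next (fun h => hne (next_eq_self_of_next_next h)))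
      · exact ((hL'.1 b hb).symm.step (walkStep_next hne)).symm
    · exact ((hL'.1 b hb).symm.step (walkStep_next_next hne)).symm
  · have := hp.length_eq
    simp only [List.length_cons] at this ⊢
    omega

end Walks

/-! ### The relations as identities in the quotient. -/

section Relations

theorem mk_relator_eq_zero {r : UTDiagram k →₀ ℂ} (h : HomotopyRelator k r) :
    (Submodule.Quotient.mk r : LinkHomotopySpace k) = 0 :=
  (Submodule.Quotient.mk_eq_zero _).2 (Submodule.subset_span h)

theorem toSpace_eq_of_isomorphic {D E : UTDiagram k} (h : D.Isomorphic E) :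
    D.toSpace = E.toSpace :=
  sub_eq_zero.1 (mk_relator_eq_zero (.iso D E h))

theorem toSpace_eq_zero_of_hasLoop {D : UTDiagram k} (h : D.HasLoop) : D.toSpace = 0 :=
  mk_relator_eq_zero (.loop D h)

theorem toSpace_eq_zero_of_hasRepeatedColor {D : UTDiagram k} (h : D.HasRepeatedColor) :
    D.toSpace = 0 :=
  mk_relator_eq_zero (.repeatedColor D h)

theorem toSpace_add_rewire_swap {D : UTDiagram k} [inst : DecidableEq D.HalfEdge]
    (h : D.HalfEdge) (hh : D.next h ≠ h) :
    D.toSpace + (D.rewire (Equiv.swap (D.next h) (D.next (D.next h)))).toSpace = 0 := by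
  obtain rfl : inst = fun a b => Classical.propDecidable (a = b) := Subsingleton.elim _ _
  exact mk_relator_eq_zero (.antisymmetry D h hh)

theorem toSpace_ihx {D : UTDiagram k} [inst : DecidableEq D.HalfEdge]
    (h a b c : D.HalfEdge) (ha : a = D.next h) (hb : b = D.next a) (hc : c = D.next (D.inv h))
    (h_tri : D.next h ≠ h) (h_tri' : D.next (D.inv h) ≠ D.inv h)
    (h_ne : D.vertexOf h ≠ D.vertexOf (D.inv h)) :
    D.toSpace + (D.rewire (Equiv.swap a b * Equiv.swap b c)).toSpace +
      (D.rewire ((Equiv.swap a b * Equiv.swap b c) ^ 2)).toSpace = 0 := by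
  obtain rfl : inst = fun a b => Classical.propDecidable (a = b) := Subsingleton.elim _ _
  exact mk_relator_eq_zero (.ihx D h a b c ha hb hc h_tri h_tri' h_ne)

open Classical in
/-- The summand of the link relation at `s` that belongs to the half-edge `x`. -/
noncomputable def attachTerm (D : UTDiagram k) (s : D.HalfEdge) (hs : D.next s = s)
    (x : D.HalfEdge) : LinkHomotopySpace k :=
  if h : x ≠ s ∧ ∃ hx : D.next x = x, D.color x hx = D.color s hs then
    (D.attach s x hs h.2.1 h.1).toSpace
  else 0

theorem attachTerm_eq {D : UTDiagram k} {s x : D.HalfEdge} (hs : D.next s = s)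
    (hx : D.next x = x) (hne : x ≠ s) (hc : D.color x hx = D.color s hs) :
    D.attachTerm s hs x = (D.attach s x hs hx hne).toSpace :=
  dif_pos ⟨hne, hx, hc⟩

theorem attachTerm_eq_zero {D : UTDiagram k} {s x : D.HalfEdge} (hs : D.next s = s)
    (h : ∀ (hx : D.next x = x) (hne : x ≠ s), D.color x hx = D.color s hs →
      (D.attach s x hs hx hne).toSpace = 0) :
    D.attachTerm s hs x = 0 := by
  unfold attachTerm
  split_ifs with h'
  · exact h _ _ h'.2.2
  · rfl

/-- The link relation, extended by zero to all half-edges, so that the sum can be split along a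
disjoint union. -/
theorem sum_attachTerm {D : UTDiagram k} [inst : Fintype D.HalfEdge] (s : D.HalfEdge)
    (hs : D.next s = s) : ∑ x, D.attachTerm s hs x = 0 := by
  classical
  obtain rfl : inst = instFintypeHalfEdge D := Subsingleton.elim _ _
  have h := mk_relator_eq_zero (.link D s hs)
  rw [← Submodule.mkQ_apply, map_sum] at h
  rw [← h, ← Finset.sum_filter_add_sum_filter_not Finset.univ
    (fun x => x ≠ s ∧ ∃ hx : D.next x = x, D.color x hx = D.color s hs),
    Finset.sum_subtype (F := inferInstance) (p := fun x => x ≠ s ∧ ∃ hx : D.next x = x, D.color x hx = D.color s hs)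
      _ (by simp)]
  rw [Finset.sum_eq_zero (s := Finset.univ.filter fun x =>
    ¬ (x ≠ s ∧ ∃ hx : D.next x = x, D.color x hx = D.color s hs)), add_zero]
  · refine Finset.sum_congr ?_ fun x _ => ?_
    · ext; simp
    · exact attachTerm_eq hs x.2.2.1 x.2.1 x.2.2.2
  · intro x hx
    exact dif_neg (Finset.mem_filter.1 hx).2

end Relations

end UTDiagram

/-! ### Disjoint unions of a distinguished diagram, chords and a rest. -/

/-- A diagram as in `UTDiagram`, but possibly empty. -/
structure PreDiagram (k : ℕ) where
  HalfEdge : Type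
  finite : Finite HalfEdge
  inv : Equiv.Perm HalfEdge
  inv_inv : ∀ h, inv (inv h) = h
  inv_ne : ∀ h, inv h ≠ h
  next : Equiv.Perm HalfEdge
  next_next_next : ∀ h, next (next (next h)) = h
  color : ∀ h, next h = h → Fin k

attribute [instance] PreDiagram.finite

namespace UTDiagram

variable {k : ℕ}

theorem isomorphic_of_bijective {D E : UTDiagram k} (f : D.HalfEdge → E.HalfEdge)
    (hf : Function.Bijective f) (hinv : ∀ h, f (D.inv h) = E.inv (f h))
    (hnext : ∀ h, f (D.next h) = E.next (f h))
    (hcolor : ∀ h (hD : D.next h = h) (hE : E.next (f h) = f h),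
      E.color (f h) hE = D.color h hD) : D.Isomorphic E :=
  ⟨Equiv.ofBijective f hf, hinv, hnext, hcolor⟩

theorem color_congr (D : UTDiagram k) {x y : D.HalfEdge} (h : x = y) (hx : D.next x = x)
    (hy : D.next y = y) : D.color x hx = D.color y hy := by
  subst h; rfl

theorem Isomorphic.symm {D E : UTDiagram k} (h : D.Isomorphic E) : E.Isomorphic D := by
  obtain ⟨f, h1, h2, h3⟩ := h
  refine ⟨f.symm, fun x => ?_, fun x => ?_, fun x hE hD => ?_⟩
  · rw [Equiv.symm_apply_eq, h1, Equiv.apply_symm_apply]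
  · rw [Equiv.symm_apply_eq, h2, Equiv.apply_symm_apply]
  · rw [← h3 _ hD (by simpa using hE)]
    exact color_congr _ (f.apply_symm_apply x) _ _

/-- The disjoint union of a diagram, of chords indexed by `J` with the given pairs of colours at
their ends, and of a further diagram. -/
def assemble (T : UTDiagram k) (J : Type) [Finite J] (c : J → Fin k × Fin k)
    (M : PreDiagram k) : UTDiagram k where
  HalfEdge := T.HalfEdge ⊕ (J × Bool ⊕ M.HalfEdge)
  finite := inferInstance
  nonempty := inferInstance
  inv := Equiv.sumCongr T.inv
    (Equiv.sumCongr (Equiv.prodCongr (Equiv.refl J) Equiv.boolNot) M.inv)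
  inv_inv h := by rcases h with h | ⟨j, b⟩ | h <;> simp [T.inv_inv, M.inv_inv]
  inv_ne h := by
    rcases h with h | ⟨j, b⟩ | h
    · simpa using T.inv_ne h
    · simp
    · simpa using M.inv_ne h
  next := Equiv.sumCongr T.next (Equiv.sumCongr (Equiv.refl _) M.next)
  next_next_next h := by
    rcases h with h | ⟨j, b⟩ | h <;> simp [T.next_next_next, M.next_next_next]
  color h hh :=
    match h, hh with
    | Sum.inl h, hh => T.color h (Sum.inl.inj hh)
    | Sum.inr (Sum.inl (j, b)), _ => if b then (c j).2 else (c j).1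
    | Sum.inr (Sum.inr h), hh => M.color h (Sum.inr.inj (Sum.inr.inj hh))

section Assemble

variable (T : UTDiagram k) (J : Type) [Finite J] (c : J → Fin k × Fin k) (M : PreDiagram k)

@[simp] theorem assemble_inv_inl (h : T.HalfEdge) :
    (assemble T J c M).inv (Sum.inl h) = Sum.inl (T.inv h) := rfl

@[simp] theorem assemble_next_inl (h : T.HalfEdge) :
    (assemble T J c M).next (Sum.inl h) = Sum.inl (T.next h) := rfl

theorem assemble_isomorphic {T T' : UTDiagram k} {J J' : Type} [Finite J] [Finite J']
    {c : J → Fin k × Fin k} {c' : J' → Fin k × Fin k} (hT : T.Isomorphic T') (e : J ≃ J')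
    (he : ∀ j, c' (e j) = c j) (M : PreDiagram k) :
    (assemble T J c M).Isomorphic (assemble T' J' c' M) := by
  obtain ⟨f, h1, h2, h3⟩ := hT
  refine ⟨Equiv.sumCongr f (Equiv.sumCongr (Equiv.prodCongr e (Equiv.refl _)) (Equiv.refl _)),
    ?_, ?_, ?_⟩
  · rintro (h | ⟨j, b⟩ | h)
    · exact congrArg Sum.inl (h1 h)
    · rfl
    · rfl
  · rintro (h | ⟨j, b⟩ | h)
    · exact congrArg Sum.inl (h2 h)
    · rfl
    · rfl
  · rintro (h | ⟨j, b⟩ | h) hD hE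
    · exact h3 h _ _
    · change (if b then (c' (e j)).2 else (c' (e j)).1) = if b then (c j).2 else (c j).1
      rw [he]
    · rfl

theorem assemble_rewire_isomorphic {T T' : UTDiagram k} {p : Equiv.Perm T.HalfEdge}
    (hT : (T.rewire p).Isomorphic T') {q : Equiv.Perm (assemble T J c M).HalfEdge}
    (hq : q = Equiv.sumCongr p (Equiv.refl _)) :
    ((assemble T J c M).rewire q).Isomorphic (assemble T' J c M) := by
  obtain ⟨f, h1, h2, h3⟩ := hT
  subst hq
  refine ⟨Equiv.sumCongr f (Equiv.refl _), ?_, ?_, ?_⟩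
  · rintro (h | ⟨j, b⟩ | h)
    · exact congrArg Sum.inl (h1 h)
    · rfl
    · rfl
  · rintro (h | ⟨j, b⟩ | h)
    · exact congrArg Sum.inl (h2 h)
    · rfl
    · rfl
  · rintro (h | ⟨j, b⟩ | h) hD hE
    · exact h3 h _ _
    · rfl
    · rfl

theorem swap_inl_eq_sumCongr {α β : Type} [DecidableEq α] [inst : DecidableEq (α ⊕ β)]
    (a b : α) :
    (Equiv.swap (Sum.inl a) (Sum.inl b) : Equiv.Perm (α ⊕ β)) =
      Equiv.sumCongr (Equiv.swap a b) (Equiv.refl β) := by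
  classical
  obtain rfl : inst = instDecidableEqSum := Subsingleton.elim _ _
  exact (Equiv.Perm.sumCongr_swap_one a b).symm

theorem toSpace_assemble_add_of_swap {T T' : UTDiagram k} [DecidableEq T.HalfEdge]
    (h : T.HalfEdge) (hh : T.next h ≠ h)
    (hT : (T.rewire (Equiv.swap (T.next h) (T.next (T.next h)))).Isomorphic T') :
    (assemble T J c M).toSpace + (assemble T' J c M).toSpace = 0 := by
  let inst : DecidableEq (assemble T J c M).HalfEdge := Classical.decEq _
  rw [← toSpace_add_rewire_swap (D := assemble T J c M) (Sum.inl h)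
      (fun e => hh (Sum.inl.inj e)),
    ← toSpace_eq_of_isomorphic (assemble_rewire_isomorphic J c M hT
      (@swap_inl_eq_sumCongr _ _ _ inst _ _))]
  rfl

theorem SameComponent.assemble {x y : T.HalfEdge} (h : T.SameComponent x y) :
    (assemble T J c M).SameComponent (Sum.inl x) (Sum.inl y) := by
  induction h with
  | rel x y h =>
    rcases h with rfl | rfl
    · exact sameComponent_inv (D := UTDiagram.assemble T J c M) (Sum.inl x)
    · exact sameComponent_next (D := UTDiagram.assemble T J c M) (Sum.inl x)
  | refl x => exact .refl _
  | symm _ _ _ ih => exact ih.symm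
  | trans _ _ _ _ _ ih1 ih2 => exact ih1.trans ih2

theorem HasRepeatedColor.assemble (h : T.HasRepeatedColor) :
    (assemble T J c M).HasRepeatedColor := by
  obtain ⟨x, y, hx, hy, hne, hs, hc⟩ := h
  exact ⟨Sum.inl x, Sum.inl y, congrArg Sum.inl hx, congrArg Sum.inl hy,
    fun e => hne (Sum.inl.inj e), hs.assemble T J c M, hc⟩

end Assemble

/-! ### Attaching an end to a chord. -/

/-- `G` is obtained from `t` by attaching the end at `s` to a chord with the same colour at one
end and the colour `m` at the other, next to the former end. -/
structure Graft (t : UTDiagram k) (s : t.HalfEdge) (m : Fin k) (G : UTDiagram k) where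
  /-- The half-edges of `G` are those of `t`, of the chord, and of the new edge. -/
  e : (t.HalfEdge ⊕ Bool) ⊕ Bool ≃ G.HalfEdge
  inv_old : ∀ h, G.inv (e (Sum.inl (Sum.inl h))) = e (Sum.inl (Sum.inl (t.inv h)))
  inv_chord : ∀ b, G.inv (e (Sum.inl (Sum.inr b))) = e (Sum.inl (Sum.inr !b))
  inv_new : ∀ b, G.inv (e (Sum.inr b)) = e (Sum.inr !b)
  next_old : ∀ h, h ≠ s → G.next (e (Sum.inl (Sum.inl h))) = e (Sum.inl (Sum.inl (t.next h)))
  next_s : G.next (e (Sum.inl (Sum.inl s))) = e (Sum.inl (Sum.inr false))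
  next_chord : G.next (e (Sum.inl (Sum.inr false))) = e (Sum.inr true)
  next_new : G.next (e (Sum.inr true)) = e (Sum.inl (Sum.inl s))
  next_chord_end : G.next (e (Sum.inl (Sum.inr true))) = e (Sum.inl (Sum.inr true))
  next_new_end : G.next (e (Sum.inr false)) = e (Sum.inr false)
  color_old : ∀ h hG ht, h ≠ s → G.color (e (Sum.inl (Sum.inl h))) hG = t.color h ht
  color_chord_end : ∀ hG, G.color (e (Sum.inl (Sum.inr true))) hG = m
  color_new_end : ∀ hG hs, G.color (e (Sum.inr false)) hG = t.color s hs

/-- The inclusion of the half-edges after grafting a chord, in terms of the original ones. -/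
def Graft.toAttach {t : UTDiagram k} {s : t.HalfEdge} {m : Fin k} {G : UTDiagram k}
    (g : Graft t s m G) {J : Type} (M : PreDiagram k) (j : J) (b : Bool) :
    G.HalfEdge ⊕ ({j' : J // j' ≠ j} × Bool ⊕ M.HalfEdge) →
      (t.HalfEdge ⊕ (J × Bool ⊕ M.HalfEdge)) ⊕ Bool
  | Sum.inl y =>
    match g.e.symm y with
    | Sum.inl (Sum.inl h) => Sum.inl (Sum.inl h)
    -- The half of the chord that meets `s` is labelled `false` in `G` and `b` in the chord `j`;
    -- `xor` matches the labels.
    | Sum.inl (Sum.inr b') => Sum.inl (Sum.inr (Sum.inl (j, xor b' b)))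
    | Sum.inr b' => Sum.inr b'
  | Sum.inr (Sum.inl (j', b')) => Sum.inl (Sum.inr (Sum.inl (j'.1, b')))
  | Sum.inr (Sum.inr x) => Sum.inl (Sum.inr (Sum.inr x))

section Graft

variable {t : UTDiagram k} {s : t.HalfEdge} {m : Fin k} {G : UTDiagram k}
  (g : Graft t s m G) {J : Type} (M : PreDiagram k) (j : J) (b : Bool)

theorem Graft.toAttach_old (h : t.HalfEdge) :
    g.toAttach M j b (Sum.inl (g.e (Sum.inl (Sum.inl h)))) = Sum.inl (Sum.inl h) := by
  simp [Graft.toAttach]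

theorem Graft.toAttach_chord (b' : Bool) :
    g.toAttach M j b (Sum.inl (g.e (Sum.inl (Sum.inr b')))) =
      Sum.inl (Sum.inr (Sum.inl (j, xor b' b))) := by
  simp [Graft.toAttach]

theorem Graft.toAttach_new (b' : Bool) :
    g.toAttach M j b (Sum.inl (g.e (Sum.inr b'))) = Sum.inr b' := by
  simp [Graft.toAttach]

theorem Graft.toAttach_bijective : Function.Bijective (g.toAttach M j b) := by
  constructor
  · rintro (x | ⟨⟨j1, h1⟩, b1⟩ | x) (y | ⟨⟨j2, h2⟩, b2⟩ | y) h
    · obtain ⟨x, rfl⟩ := g.e.surjective x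
      obtain ⟨y, rfl⟩ := g.e.surjective y
      rcases x with (x | x) | x <;> rcases y with (y | y) | y <;>
        simp_all [Graft.toAttach]
    all_goals try
      (obtain ⟨x, rfl⟩ := g.e.surjective x
       rcases x with (x | x) | x <;> simp_all [Graft.toAttach])
    all_goals try
      (obtain ⟨y, rfl⟩ := g.e.surjective y
       rcases y with (y | y) | y <;> simp_all [Graft.toAttach])
    all_goals simp_all [Graft.toAttach]
  · rintro ((x | ⟨j', b'⟩ | x) | x)
    · exact ⟨_, g.toAttach_old M j b x⟩
    · by_cases hj : j' = j
      · subst hj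
        exact ⟨_, (g.toAttach_chord M j' b (xor b' b)).trans (by simp)⟩
      · exact ⟨Sum.inr (Sum.inl (⟨j', hj⟩, b')), rfl⟩
    · exact ⟨Sum.inr (Sum.inr x), rfl⟩
    · exact ⟨_, g.toAttach_new M j b x⟩

/-- The chord `j` is absorbed into the component of `s`, so one chord fewer remains; `hm` says that
`m` is the color of the end that is not used. -/
theorem Graft.attach_isomorphic [Finite J] (c : J → Fin k × Fin k) (g : Graft t s m G)
    (hs : t.next s = s)
    (hx : (assemble t J c M).next (Sum.inr (Sum.inl (j, b))) = Sum.inr (Sum.inl (j, b)))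
    (hne : (Sum.inr (Sum.inl (j, b)) : (assemble t J c M).HalfEdge) ≠ Sum.inl s)
    (hc : (assemble t J c M).color (Sum.inr (Sum.inl (j, b))) hx = t.color s hs)
    (hm : (if b then (c j).1 else (c j).2) = m) :
    ((assemble t J c M).attach (Sum.inl s) (Sum.inr (Sum.inl (j, b)))
      (congrArg Sum.inl hs) hx hne).Isomorphic
      (assemble G {j' : J // j' ≠ j} (fun j' => c j'.1) M) := by
  apply Isomorphic.symm
  refine isomorphic_of_bijective (g.toAttach M j b) (g.toAttach_bijective M j b) ?_ ?_ ?_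
  · rintro (x | ⟨⟨j1, h1⟩, b1⟩ | x)
    · obtain ⟨x, rfl⟩ := g.e.surjective x
      rcases x with (x | x) | x
      · rw [assemble_inv_inl, g.inv_old, g.toAttach_old, g.toAttach_old]
        rfl
      · rw [assemble_inv_inl, g.inv_chord, g.toAttach_chord, g.toAttach_chord]
        cases x <;> cases b <;> rfl
      · rw [assemble_inv_inl, g.inv_new, g.toAttach_new, g.toAttach_new]
        rfl
    · rfl
    · rfl
  · intro x
    change _ = (assemble t J c M).attachNext _ _ _
    rcases x with x | ⟨⟨j1, h1⟩, b1⟩ | x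
    · obtain ⟨x, rfl⟩ := g.e.surjective x
      rw [assemble_next_inl]
      rcases x with (x | x) | x
      · by_cases h : x = s
        · subst h
          rw [g.next_s, g.toAttach_chord, g.toAttach_old, Bool.false_xor]
          exact (attachNext_s (assemble t J c M) hx hne).symm
        · rw [g.next_old _ h, g.toAttach_old, g.toAttach_old]
          exact (attachNext_of_ne (assemble t J c M) (h := Sum.inl x)
            (fun e => h (Sum.inl.inj e)) Sum.inl_ne_inr).symm
      · cases x
        · rw [g.next_chord, g.toAttach_new, g.toAttach_chord, Bool.false_xor]
          exact (attachNext_x (assemble t J c M) _ _).symm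
        · rw [g.next_chord_end, g.toAttach_chord]
          refine (attachNext_of_ne (assemble t J c M) (h := Sum.inr (Sum.inl (j, xor true b)))
            Sum.inr_ne_inl fun e => ?_).symm
          have := congrArg Prod.snd (Sum.inl.inj (Sum.inr.inj e))
          cases b <;> cases this
      · cases x
        · rw [g.next_new_end, g.toAttach_new]
          exact (attachNext_false (assemble t J c M) _ _).symm
        · rw [g.next_new, g.toAttach_new, g.toAttach_old]
          exact (attachNext_true (assemble t J c M) (congrArg Sum.inl hs)).symm
    · refine (attachNext_of_ne (assemble t J c M) (h := Sum.inr (Sum.inl (j1, b1)))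
        Sum.inr_ne_inl fun e => h1 ?_).symm
      exact congrArg Prod.fst (Sum.inl.inj (Sum.inr.inj e))
    · exact (attachNext_of_ne (assemble t J c M) (h := Sum.inr (Sum.inr x)) Sum.inr_ne_inl
        (fun e => Sum.inr_ne_inl (Sum.inr.inj e))).symm
  · rintro (x | ⟨⟨j1, h1⟩, b1⟩ | x) hD hE
    · obtain ⟨x, rfl⟩ := g.e.surjective x
      rcases x with (x | x) | x
      · have hxs : x ≠ s := by
          rintro rfl
          have := Sum.inl.inj hD
          rw [g.next_s] at this
          simpa using g.e.injective this
        have hE' := hE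
        rw [g.toAttach_old] at hE'
        rw [color_congr _ (g.toAttach_old M j b x) hE hE']
        exact (g.color_old x _ _ hxs).symm
      · cases x
        · have := Sum.inl.inj hD
          rw [g.next_chord] at this
          simpa using g.e.injective this
        · have hE' := hE
          rw [g.toAttach_chord] at hE'
          rw [color_congr _ (g.toAttach_chord M j b true) hE hE']
          refine Eq.trans ?_ (g.color_chord_end _).symm
          rw [← hm]
          cases b <;> rfl
      · cases x
        · have hE' := hE
          rw [g.toAttach_new] at hE'
          rw [color_congr _ (g.toAttach_new M j b false) hE hE']
          refine Eq.trans ?_ (g.color_new_end _ hs).symm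
          rw [← hc]
          rfl
        · have := Sum.inl.inj hD
          rw [g.next_new] at this
          simpa using g.e.injective this
    · rfl
    · rfl

end Graft

/-- Orbits of `next` have at most three elements. This reduces distinctness of vertices, as required
by IHX, to inequalities that can be decided. -/
theorem eq_of_vertexOf_eq {D : UTDiagram k} {x y : D.HalfEdge} (h : D.vertexOf x = D.vertexOf y) :
    y = x ∨ y = D.next x ∨ y = D.next (D.next x) := by
  have h' : D.next.SameCycle x y := Quotient.exact h
  obtain ⟨i, -, rfl⟩ := h'.exists_pow_eq'
  clear h h'
  induction i with
  | zero => exact Or.inl rfl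
  | succ i ih =>
    rw [pow_succ', Equiv.Perm.mul_apply]
    rcases ih with e | e | e <;> rw [e]
    · exact Or.inr (Or.inl rfl)
    · exact Or.inr (Or.inr rfl)
    · exact Or.inl (D.next_next_next x)

theorem swap_mul_swap_inl {α β : Type} [DecidableEq α] [DecidableEq (α ⊕ β)] (a b d : α) :
    (Equiv.swap (Sum.inl a) (Sum.inl b) * Equiv.swap (Sum.inl b) (Sum.inl d) :
      Equiv.Perm (α ⊕ β)) =
      Equiv.sumCongr (Equiv.swap a b * Equiv.swap b d) (Equiv.refl β) := by
  rw [swap_inl_eq_sumCongr, swap_inl_eq_sumCongr]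
  exact Equiv.Perm.sumCongr_mul _ _ _ _

theorem swap_mul_swap_inl_sq {α β : Type} [DecidableEq α] [DecidableEq (α ⊕ β)] (a b d : α) :
    (Equiv.swap (Sum.inl a) (Sum.inl b) * Equiv.swap (Sum.inl b) (Sum.inl d) :
      Equiv.Perm (α ⊕ β)) ^ 2 =
      Equiv.sumCongr ((Equiv.swap a b * Equiv.swap b d) ^ 2) (Equiv.refl β) := by
  rw [swap_mul_swap_inl, pow_two, pow_two]
  exact Equiv.Perm.sumCongr_mul _ _ _ _

section Assemble

variable {T : UTDiagram k} (J : Type) [Finite J] (c : J → Fin k × Fin k) (M : PreDiagram k)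

theorem toSpace_assemble_ihx {T₁ T₂ : UTDiagram k} [DecidableEq T.HalfEdge]
    (h a b d : T.HalfEdge) (ha : a = T.next h) (hb : b = T.next a) (hd : d = T.next (T.inv h))
    (h_tri : T.next h ≠ h) (h_tri' : T.next (T.inv h) ≠ T.inv h) (h_ne : T.inv h ≠ T.next h)
    (h_ne' : T.inv h ≠ T.next (T.next h))
    (h₁ : (T.rewire (Equiv.swap a b * Equiv.swap b d)).Isomorphic T₁)
    (h₂ : (T.rewire ((Equiv.swap a b * Equiv.swap b d) ^ 2)).Isomorphic T₂) :
    (assemble T J c M).toSpace + (assemble T₁ J c M).toSpace + (assemble T₂ J c M).toSpace = 0 := by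
  let inst : DecidableEq (T.HalfEdge ⊕ (J × Bool ⊕ M.HalfEdge)) := Classical.decEq _
  rw [← toSpace_eq_of_isomorphic (assemble_rewire_isomorphic J c M h₁ (swap_mul_swap_inl a b d)),
    ← toSpace_eq_of_isomorphic (assemble_rewire_isomorphic J c M h₂ (swap_mul_swap_inl_sq a b d))]
  refine toSpace_ihx (D := assemble T J c M) (inst := inst) (Sum.inl h) (Sum.inl a) (Sum.inl b) (Sum.inl d)
    (congrArg Sum.inl ha) (congrArg Sum.inl hb) (congrArg Sum.inl hd)
    (fun e => h_tri (Sum.inl.inj e)) (fun e => h_tri' (Sum.inl.inj e)) fun e => ?_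
  rcases eq_of_vertexOf_eq e with e | e | e
  · exact T.inv_ne h (Sum.inl.inj e)
  · exact h_ne (Sum.inl.inj e)
  · exact h_ne' (Sum.inl.inj e)

/-- The link relation, sorted by the place of `x`: by `ht` nothing comes from `t`, by `hM` nothing
from `M`, and each chord contributes through either of its ends. -/
theorem sum_toSpace_assemble_graft {t : UTDiagram k} {s : t.HalfEdge} (hs : t.next s = s)
    {G : Fin k → UTDiagram k} (g : ∀ m, Graft t s m (G m)) {J : Type} [Fintype J]
    (c : J → Fin k × Fin k)
    (ht : ∀ x (hx : t.next x = x), t.color x hx = t.color s hs → x = s)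
    (hM : ∀ x, (assemble t J c M).attachTerm (Sum.inl s) (congrArg Sum.inl hs)
      (Sum.inr (Sum.inr x)) = 0) :
    ∑ j, ((if (c j).1 = t.color s hs then
        (assemble (G (c j).2) {j' // j' ≠ j} (fun j' => c j'.1) M).toSpace else 0) +
      (if (c j).2 = t.color s hs then
        (assemble (G (c j).1) {j' // j' ≠ j} (fun j' => c j'.1) M).toSpace else 0)) = 0 := by
  classical
  have := Fintype.ofFinite M.HalfEdge
  let inst : Fintype (t.HalfEdge ⊕ (J × Bool ⊕ M.HalfEdge)) := inferInstance
  have h := sum_attachTerm (D := assemble t J c M) (inst := inst)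
    (Sum.inl s) (congrArg Sum.inl hs)
  have h' := (Fintype.sum_sum_type (fun x : t.HalfEdge ⊕ (J × Bool ⊕ M.HalfEdge) =>
    (assemble t J c M).attachTerm (Sum.inl s) (congrArg Sum.inl hs) x)).symm.trans h
  rw [Fintype.sum_sum_type, Fintype.sum_prod_type] at h'
  simp only [Fintype.sum_bool] at h'
  rw [Finset.sum_eq_zero (fun x _ => hM x), add_zero, Finset.sum_eq_zero, zero_add] at h'
  · refine (Finset.sum_congr rfl fun j _ => ?_).trans h'
    rw [add_comm]
    congr 1
    · split_ifs with hc
      · exact ((attachTerm_eq (D := assemble t J c M) (s := Sum.inl s)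
          (x := Sum.inr (Sum.inl (j, true))) (congrArg Sum.inl hs) rfl Sum.inr_ne_inl hc).trans
          (toSpace_eq_of_isomorphic ((g (c j).1).attach_isomorphic M j true c hs rfl
            Sum.inr_ne_inl hc rfl))).symm
      · exact (attachTerm_eq_zero (D := assemble t J c M) (s := Sum.inl s)
          (x := Sum.inr (Sum.inl (j, true))) (congrArg Sum.inl hs)
          fun _ _ e => absurd e hc).symm
    · split_ifs with hc
      · exact ((attachTerm_eq (D := assemble t J c M) (s := Sum.inl s)
          (x := Sum.inr (Sum.inl (j, false))) (congrArg Sum.inl hs) rfl Sum.inr_ne_inl hc).trans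
          (toSpace_eq_of_isomorphic ((g (c j).2).attach_isomorphic M j false c hs rfl
            Sum.inr_ne_inl hc rfl))).symm
      · exact (attachTerm_eq_zero (D := assemble t J c M) (s := Sum.inl s)
          (x := Sum.inr (Sum.inl (j, false))) (congrArg Sum.inl hs)
          fun _ _ e => absurd e hc).symm
  · intro x _
    exact attachTerm_eq_zero (D := assemble t J c M) _ fun hx hne e =>
      absurd (congrArg Sum.inl (ht x (Sum.inl.inj hx) e)) hne

end Assemble

/-! ### Generating functions in the chord multiplicities. -/

/-- The diagram with component `T`, with `a (i, j)` chords of colours `i` and `j`, and with `M`. -/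
abbrev withChords (T : UTDiagram k) (M : PreDiagram k) (a : Fin k × Fin k →₀ ℕ) : UTDiagram k :=
  assemble T (Σ p, Fin (a p)) Sigma.fst M

theorem assemble_isomorphic_withChords (T : UTDiagram k) (M : PreDiagram k) {J : Type} [Finite J]
    (c : J → Fin k × Fin k) (a : Fin k × Fin k →₀ ℕ) (h : ∀ p, Nat.card {j // c j = p} = a p) :
    (assemble T J c M).Isomorphic (withChords T M a) := by
  refine assemble_isomorphic ⟨Equiv.refl _, fun _ => rfl, fun _ => rfl, fun _ _ _ => rfl⟩
    ((Equiv.sigmaFiberEquiv c).symm.trans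
      (Equiv.sigmaCongrRight fun p => Finite.equivFinOfCardEq (h p))) (fun j => rfl) M

theorem assemble_remove_isomorphic (T : UTDiagram k) (M : PreDiagram k)
    (a : Fin k × Fin k →₀ ℕ) (j : Σ p, Fin (a p)) :
    (assemble T {j' // j' ≠ j} (fun j' => j'.1.1) M).Isomorphic
      (withChords T M (a - Finsupp.single j.1 1)) := by
  classical
  apply assemble_isomorphic_withChords
  intro p
  obtain ⟨q, r⟩ := j
  let e : {j' : {j' : Σ p, Fin (a p) // j' ≠ ⟨q, r⟩} // j'.1.1 = p} ≃
      {r' : Fin (a p) // (⟨p, r'⟩ : Σ p, Fin (a p)) ≠ ⟨q, r⟩} :=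
    { toFun := fun x => ⟨x.2 ▸ x.1.1.2, by obtain ⟨⟨⟨p', r'⟩, h1⟩, rfl⟩ := x; exact h1⟩
      invFun := fun r' => ⟨⟨⟨p, r'.1⟩, r'.2⟩, rfl⟩
      left_inv := by rintro ⟨⟨⟨p', r'⟩, h1⟩, rfl⟩; rfl
      right_inv := fun r' => rfl }
  rw [Nat.card_congr e, Finsupp.tsub_apply, Nat.card_eq_fintype_card]
  by_cases hp : p = q
  · subst hp
    simp [Fintype.card_subtype_compl]
  · have : ∀ r' : Fin (a p), (⟨p, r'⟩ : Σ p, Fin (a p)) ≠ ⟨q, r⟩ := by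
      intro r' e'
      exact hp (congrArg Sigma.fst e')
    rw [Finsupp.single_eq_of_ne hp, tsub_zero]
    simp [this]

section GeneratingFunction

variable (M : PreDiagram k) (φ : LinkHomotopySpace k →ₗ[ℂ] ℂ)

/-- The exponential generating function of the values of a functional on the diagrams that consist
of `T`, of `M`, and of chords. -/
noncomputable def gen (T : UTDiagram k) : MvPowerSeries (Fin k × Fin k) ℂ :=
  fun a => φ (withChords T M a).toSpace / ∏ p, ((a p).factorial : ℂ)

theorem coeff_gen (T : UTDiagram k) (a : Fin k × Fin k →₀ ℕ) :
    MvPowerSeries.coeff a (gen M φ T) =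
      φ (withChords T M a).toSpace / ∏ p, ((a p).factorial : ℂ) := rfl

theorem apply_toSpace_eq_zero_of_gen {T : UTDiagram k} (h : gen M φ T = 0)
    {J : Type} [Finite J] (c : J → Fin k × Fin k) : φ (assemble T J c M).toSpace = 0 := by
  classical
  let a : Fin k × Fin k →₀ ℕ := Finsupp.equivFunOnFinite.symm fun p => Nat.card {j // c j = p}
  rw [toSpace_eq_of_isomorphic (assemble_isomorphic_withChords T M c a fun p => rfl)]
  have := congrArg (MvPowerSeries.coeff a) h
  rw [coeff_gen, map_zero, div_eq_zero_iff] at this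
  refine this.resolve_right (Finset.prod_ne_zero_iff.2 fun p _ => ?_)
  exact_mod_cast (a p).factorial_ne_zero

theorem gen_eq_of_isomorphic {T T' : UTDiagram k} (h : T.Isomorphic T') :
    gen M φ T = gen M φ T' := by
  ext a
  rw [coeff_gen, coeff_gen,
    toSpace_eq_of_isomorphic (assemble_isomorphic (c := Sigma.fst) (c' := Sigma.fst) h (Equiv.refl _)
      (fun _ => rfl) M)]

theorem gen_eq_zero_of_hasRepeatedColor {T : UTDiagram k} (h : T.HasRepeatedColor) :
    gen M φ T = 0 := by
  ext a
  rw [coeff_gen, toSpace_eq_zero_of_hasRepeatedColor (h.assemble T _ _ M)]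
  simp

theorem gen_add_of_swap {T T' : UTDiagram k} [DecidableEq T.HalfEdge]
    (h : T.HalfEdge) (hh : T.next h ≠ h)
    (hT : (T.rewire (Equiv.swap (T.next h) (T.next (T.next h)))).Isomorphic T') :
    gen M φ T + gen M φ T' = 0 := by
  ext a
  rw [map_add, coeff_gen, coeff_gen, ← add_div, ← map_add,
    toSpace_assemble_add_of_swap _ _ M h hh hT]
  simp

theorem gen_ihx {T T₁ T₂ : UTDiagram k} [DecidableEq T.HalfEdge]
    (h a b d : T.HalfEdge) (ha : a = T.next h) (hb : b = T.next a) (hd : d = T.next (T.inv h))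
    (h_tri : T.next h ≠ h) (h_tri' : T.next (T.inv h) ≠ T.inv h) (h_ne : T.inv h ≠ T.next h)
    (h_ne' : T.inv h ≠ T.next (T.next h))
    (h₁ : (T.rewire (Equiv.swap a b * Equiv.swap b d)).Isomorphic T₁)
    (h₂ : (T.rewire ((Equiv.swap a b * Equiv.swap b d) ^ 2)).Isomorphic T₂) :
    gen M φ T + gen M φ T₁ + gen M φ T₂ = 0 := by
  ext e
  rw [map_add, map_add, coeff_gen, coeff_gen, coeff_gen, ← add_div, ← add_div, ← map_add,
    ← map_add, toSpace_assemble_ihx _ _ M h a b d ha hb hd h_tri h_tri' h_ne h_ne' h₁ h₂]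
  simp

/-- The variable that counts the chords with colours `i` and `j`. -/
noncomputable def chordVar (i j : Fin k) : MvPowerSeries (Fin k × Fin k) ℂ :=
  MvPowerSeries.X (i, j) + MvPowerSeries.X (j, i)

/-- The factorials turn the shift of the exponent into the factor `a p`, the number of equal chords
that can be removed. -/
theorem coeff_X_mul_gen (T : UTDiagram k) (p : Fin k × Fin k) (a : Fin k × Fin k →₀ ℕ) :
    MvPowerSeries.coeff a (MvPowerSeries.X p * gen M φ T) =
      a p * φ (withChords T M (a - Finsupp.single p 1)).toSpace /
        ∏ q, ((a q).factorial : ℂ) := by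
  classical
  rw [MvPowerSeries.X, MvPowerSeries.coeff_monomial_mul]
  by_cases h : a p = 0
  · rw [if_neg (by simp [h]), h]
    simp
  · rw [if_pos (by simpa using Nat.one_le_iff_ne_zero.2 h), one_mul, coeff_gen]
    have h1 : ∏ q, ((a q).factorial : ℂ) =
        a p * ∏ q, (((a - Finsupp.single p 1 : Fin k × Fin k →₀ ℕ) q).factorial : ℂ) := by
      rw [← Finset.mul_prod_erase _ _ (Finset.mem_univ p),
        ← Finset.mul_prod_erase Finset.univ (fun q => (((a - Finsupp.single p 1 : Fin k × Fin k →₀ ℕ) q).factorial : ℂ))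
          (Finset.mem_univ p), ← mul_assoc]
      congr 1
      · rw [Finsupp.tsub_apply, Finsupp.single_eq_same]
        exact_mod_cast (Nat.mul_factorial_pred h).symm
      · refine Finset.prod_congr rfl fun q hq => ?_
        rw [Finsupp.tsub_apply, Finsupp.single_eq_of_ne (Finset.ne_of_mem_erase hq), tsub_zero]
    rw [h1, mul_div_mul_left]
    exact_mod_cast h

/-- The link relation as a linear equation over power series. Chords are indexed by ordered pairs of
colors, so the two orders of `i` and `m` combine to `chordVar i m`. -/
theorem sum_chordVar_mul_gen_graft {t : UTDiagram k} {s : t.HalfEdge} (hs : t.next s = s)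
    {G : Fin k → UTDiagram k} (g : ∀ m, Graft t s m (G m))
    (ht : ∀ x (hx : t.next x = x), t.color x hx = t.color s hs → x = s)
    (hM : ∀ a x, (withChords t M a).attachTerm (Sum.inl s) (congrArg Sum.inl hs)
      (Sum.inr (Sum.inr x)) = 0) :
    ∑ m, chordVar (t.color s hs) m * gen M φ (G m) = 0 := by
  classical
  have key : ∑ p : Fin k × Fin k, ((if p.1 = t.color s hs then
      MvPowerSeries.X p * gen M φ (G p.2) else 0) +
      (if p.2 = t.color s hs then MvPowerSeries.X p * gen M φ (G p.1) else 0)) = 0 := by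
    ext a
    have h := congrArg φ (sum_toSpace_assemble_graft M hs g
      (fun j : Σ p, Fin (a p) => j.1) ht (hM a))
    have h2 : ∀ (T : UTDiagram k) (j : Σ p, Fin (a p)),
        (assemble T {j' // j' ≠ j} (fun j' => j'.1.1) M).toSpace =
          (withChords T M (a - Finsupp.single j.1 1)).toSpace :=
      fun T j => toSpace_eq_of_isomorphic (assemble_remove_isomorphic T M a j)
    simp only [h2, Fintype.sum_sigma, Finset.sum_const, Finset.card_univ, Fintype.card_fin,
      map_sum, map_zero, map_nsmul, map_add, apply_ite φ] at h
    rw [map_sum, map_zero, ← zero_div (∏ q, ((a q).factorial : ℂ)), ← h, Finset.sum_div]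
    refine Finset.sum_congr rfl fun p _ => ?_
    rw [map_add, apply_ite (MvPowerSeries.coeff a), apply_ite (MvPowerSeries.coeff a),
      coeff_X_mul_gen, coeff_X_mul_gen, map_zero, nsmul_eq_mul, mul_add, add_div]
    congr 1 <;> split_ifs <;> simp
  rw [Finset.sum_add_distrib, Fintype.sum_prod_type, Fintype.sum_prod_type_right] at key
  simp only [Finset.sum_ite_irrel, Finset.sum_const_zero, Finset.sum_ite_eq', Finset.mem_univ,
    if_true, ← Finset.sum_add_distrib, ← add_mul] at key
  exact key

end GeneratingFunction

/-! ### Splitting off an embedded tree. -/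

section Embedding

/-- The part of a diagram on which a predicate holds. -/
def restrict (D : UTDiagram k) (P : D.HalfEdge → Prop) (hinv : ∀ x, P (D.inv x) ↔ P x)
    (hnext : ∀ x, P (D.next x) ↔ P x) : PreDiagram k where
  HalfEdge := {x // P x}
  finite := inferInstance
  inv := D.inv.subtypePerm hinv
  inv_inv h := Subtype.ext (D.inv_inv h)
  inv_ne h e := D.inv_ne h (congrArg Subtype.val e)
  next := D.next.subtypePerm hnext
  next_next_next h := Subtype.ext (D.next_next_next h)
  color h hh := D.color h (congrArg Subtype.val hh)

/-- No component is a chord. -/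
def _root_.PreDiagram.ChordFree (M : PreDiagram k) : Prop :=
  ∀ x, M.next x = x → M.next (M.inv x) ≠ M.inv x

theorem mem_range_iff_of_comm {α β : Type} {f : α → β} {p : Equiv.Perm α} {q : Equiv.Perm β}
    (h : ∀ x, f (p x) = q (f x)) (y : β) : q y ∈ Set.range f ↔ y ∈ Set.range f := by
  constructor
  · rintro ⟨x, hx⟩
    refine ⟨p.symm x, q.injective ?_⟩
    rw [← h, Equiv.apply_symm_apply, hx]
  · rintro ⟨x, rfl⟩
    exact ⟨p x, h x⟩

/-- The image of `f` is closed under `inv` and `next`, hence a union of components; the complement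
is sorted into chords and everything else. -/
theorem exists_isomorphic_assemble {D E : UTDiagram k} (f : E.HalfEdge → D.HalfEdge)
    (hf : Function.Injective f) (hinv : ∀ x, f (E.inv x) = D.inv (f x))
    (hnext : ∀ x, f (E.next x) = D.next (f x))
    (hcolor : ∀ x hE hD, D.color (f x) hD = E.color x hE) :
    ∃ (J : Type) (_ : Finite J) (c : J → Fin k × Fin k) (M : PreDiagram k), M.ChordFree ∧
      D.Isomorphic (assemble E J c M) := by
  classical
  let K : D.HalfEdge → Prop := fun x => D.next x = x ∧ D.next (D.inv x) = D.inv x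
  have hK : ∀ x, K (D.inv x) ↔ K x := fun x => by
    simp only [K, D.inv_inv]; exact and_comm
  have hK' : ∀ x, K (D.next x) ↔ K x := fun x => by
    constructor
    · intro h
      have := next_eq_self_of_next_next h.1
      rwa [this] at h
    · intro h
      rwa [h.1]
  let P : D.HalfEdge → Prop := fun x => x ∉ Set.range f ∧ ¬ K x
  let M := D.restrict P (fun x => and_congr (not_congr (mem_range_iff_of_comm hinv x))
    (not_congr (hK x))) (fun x => and_congr (not_congr (mem_range_iff_of_comm hnext x))
    (not_congr (hK' x)))
  -- An arbitrary numbering selects one half of each chord, so that every chord is counted once.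
  let e := Fintype.equivFin D.HalfEdge
  let J := {x // (x ∉ Set.range f ∧ K x) ∧ e x < e (D.inv x)}
  refine ⟨J, inferInstance, fun x => (D.color x x.2.1.2.1, D.color (D.inv x) x.2.1.2.2), M,
    fun x hx hx' => x.2.2 ⟨congrArg Subtype.val hx, congrArg Subtype.val hx'⟩, ?_⟩
  apply Isomorphic.symm
  let F : E.HalfEdge ⊕ (J × Bool ⊕ {x // P x}) → D.HalfEdge
    | Sum.inl x => f x
    | Sum.inr (Sum.inl (x, b)) => if b then D.inv x else x
    | Sum.inr (Sum.inr x) => x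
  have hJ : ∀ (x : J) (b : Bool), (if b then D.inv x else x) ∉ Set.range f ∧
      K (if b then D.inv x else x) := by
    rintro ⟨x, hx, hlt⟩ b
    cases b
    · exact hx
    · exact ⟨fun h => hx.1 ((mem_range_iff_of_comm hinv x).1 h), (hK x).2 hx.2⟩
  refine isomorphic_of_bijective F ⟨?_, ?_⟩ ?_ ?_ ?_
  · rintro (x | ⟨x, b⟩ | x) (y | ⟨y, b'⟩ | y) h
    · exact congrArg Sum.inl (hf h)
    · exact absurd ⟨x, h⟩ (hJ y b').1
    · exact absurd ⟨x, h⟩ y.2.1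
    · exact absurd ⟨y, h.symm⟩ (hJ x b).1
    · obtain ⟨x, hx, hlt⟩ := x
      obtain ⟨y, hy, hlt'⟩ := y
      change (if b then D.inv x else x) = (if b' then D.inv y else y) at h
      cases b <;> cases b'
      · obtain rfl : x = y := h
        rfl
      · obtain rfl : x = D.inv y := h
        rw [D.inv_inv] at hlt
        exact absurd hlt hlt'.asymm
      · obtain rfl : D.inv x = y := h
        rw [D.inv_inv] at hlt'
        exact absurd hlt' hlt.asymm
      · obtain rfl : x = y := D.inv.injective h
        rfl
    · have := (hJ x b).2
      change (if b then D.inv x else x) = y.1 at h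
      rw [h] at this
      exact absurd this y.2.2
    · exact absurd ⟨y, h.symm⟩ x.2.1
    · have := (hJ y b').2
      change x.1 = (if b' then D.inv y else y) at h
      rw [← h] at this
      exact absurd this x.2.2
    · obtain rfl : x = y := Subtype.ext h
      rfl
  · intro x
    by_cases hx : x ∈ Set.range f
    · obtain ⟨y, rfl⟩ := hx
      exact ⟨Sum.inl y, rfl⟩
    · by_cases hx' : K x
      · rcases lt_or_gt_of_ne (fun h => D.inv_ne x (e.injective h) :
          e (D.inv x) ≠ e x) with h | h
        · refine ⟨Sum.inr (Sum.inl (⟨D.inv x, ⟨fun h => hx ((mem_range_iff_of_comm hinv x).1 h),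
            (hK x).2 hx'⟩, ?_⟩, true)), D.inv_inv x⟩
          rwa [D.inv_inv]
        · exact ⟨Sum.inr (Sum.inl (⟨x, ⟨hx, hx'⟩, h⟩, false)), rfl⟩
      · exact ⟨Sum.inr (Sum.inr ⟨x, hx, hx'⟩), rfl⟩
  · rintro (x | ⟨x, b⟩ | x)
    · exact hinv x
    · cases b
      · rfl
      · exact (D.inv_inv _).symm
    · rfl
  · rintro (x | ⟨x, b⟩ | x)
    · exact hnext x
    · exact (hJ x b).2.1.symm
    · rfl
  · rintro (x | ⟨x, b⟩ | x) h1 h2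
    · exact hcolor x _ _
    · cases b <;> rfl
    · rfl

theorem toSpace_eq_zero_of_embedding {D E : UTDiagram k} (f : E.HalfEdge → D.HalfEdge)
    (hf : Function.Injective f) (hinv : ∀ x, f (E.inv x) = D.inv (f x))
    (hnext : ∀ x, f (E.next x) = D.next (f x))
    (hcolor : ∀ x hE hD, D.color (f x) hD = E.color x hE)
    (hgen : ∀ M : PreDiagram k, M.ChordFree → ∀ φ, gen M φ E = 0) : D.toSpace = 0 := by
  obtain ⟨J, _, c, M, hM, hD⟩ := exists_isomorphic_assemble f hf hinv hnext hcolor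
  rw [toSpace_eq_of_isomorphic hD]
  exact (Module.forall_dual_apply_eq_zero_iff ℂ _).1 fun φ =>
    apply_toSpace_eq_zero_of_gen M φ (hgen M hM φ) c

/-- A map of diagrams is injective if it is so on univalent vertices, provided that walks along
the boundary of the source all pass a univalent vertex. -/
theorem injective_of_injective_on_leaves {D E : UTDiagram k} (f : E.HalfEdge → D.HalfEdge)
    (hinv : ∀ x, f (E.inv x) = D.inv (f x)) (hnext : ∀ x, f (E.next x) = D.next (f x))
    (hE : ∀ x, ∃ n, E.next ((fun y => E.next (E.inv y))^[n] x) =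
      (fun y => E.next (E.inv y))^[n] x)
    (htri : ∀ x, D.next (f x) = f x → E.next x = x)
    (hleaf : ∀ x y, E.next x = x → E.next y = y → f x = f y → x = y) :
    Function.Injective f := by
  intro x y h
  obtain ⟨n, hn⟩ := hE x
  have hsemi : Function.Semiconj f (fun y => E.next (E.inv y)) (fun y => D.next (D.inv y)) :=
    fun y => by rw [hnext, hinv]
  -- Follow the boundary walk `next ∘ inv` from `x` to a leaf. It commutes with `f`, so the walk
  -- from `y` is at a leaf at the same time, and the walk is reversible.
  have h1 : f ((fun y => E.next (E.inv y))^[n] x) = f ((fun y => E.next (E.inv y))^[n] y) := by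
    rw [hsemi.iterate_right n, hsemi.iterate_right n, h]
  have h2 : D.next (f ((fun y => E.next (E.inv y))^[n] y)) =
      f ((fun y => E.next (E.inv y))^[n] y) := by
    rw [← h1, ← hnext, hn]
  have h3 := hleaf _ _ hn (htri _ h2) h1
  have hinj : Function.Injective fun y => E.next (E.inv y) :=
    E.next.injective.comp E.inv.injective
  exact hinj.iterate n h3

end Embedding

/-! ### The trees with two to five leaves as tables. -/

/-- The diagram with half-edges `Fin n` and the given edges, vertices and colours. -/
def ofTable {n : ℕ} [NeZero n] (inv next : Fin n → Fin n) (h₁ : ∀ h, inv (inv h) = h)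
    (h₂ : ∀ h, inv h ≠ h) (h₃ : ∀ h, next (next (next h)) = h) (col : Fin n → Fin k) :
    UTDiagram k where
  HalfEdge := Fin n
  finite := inferInstance
  nonempty := ⟨0⟩
  inv := ⟨inv, inv, h₁, h₁⟩
  inv_inv := h₁
  inv_ne := h₂
  next := ⟨next, fun h => next (next h), h₃, h₃⟩
  next_next_next := h₃
  color h _ := col h

instance {n : ℕ} [NeZero n] (inv next : Fin n → Fin n) (h₁ : ∀ h, inv (inv h) = h)
    (h₂ : ∀ h, inv h ≠ h) (h₃ : ∀ h, next (next (next h)) = h) (col : Fin n → Fin k) :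
    DecidableEq (ofTable inv next h₁ h₂ h₃ col).HalfEdge :=
  inferInstanceAs (DecidableEq (Fin n))

/-- The half-edges after grafting a chord. -/
def graftMap (n : ℕ) : (Fin n ⊕ Bool) ⊕ Bool → Fin (n + 4)
  | Sum.inl (Sum.inl h) => ⟨h, by omega⟩
  | Sum.inl (Sum.inr false) => ⟨n, by omega⟩
  | Sum.inl (Sum.inr true) => ⟨n + 1, by omega⟩
  | Sum.inr true => ⟨n + 2, by omega⟩
  | Sum.inr false => ⟨n + 3, by omega⟩

theorem graftMap_bijective (n : ℕ) : Function.Bijective (graftMap n) := by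
  rw [Fintype.bijective_iff_injective_and_card]
  refine ⟨?_, by simp⟩
  rintro ((⟨x, hx⟩ | _ | _) | _ | _) ((⟨y, hy⟩ | _ | _) | _ | _) h <;>
    simp [graftMap, Fin.ext_iff] at h ⊢ <;> omega

/-- A graft of diagrams that are given by tables. -/
noncomputable def Graft.ofTable {n : ℕ} [NeZero n] {inv next : Fin n → Fin n}
    {h₁ : ∀ h, inv (inv h) = h} {h₂ : ∀ h, inv h ≠ h} {h₃ : ∀ h, next (next (next h)) = h}
    {col : Fin n → Fin k} {inv' next' : Fin (n + 4) → Fin (n + 4)}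
    {h₁' : ∀ h, inv' (inv' h) = h} {h₂' : ∀ h, inv' h ≠ h}
    {h₃' : ∀ h, next' (next' (next' h)) = h} {col' : Fin (n + 4) → Fin k} {m : Fin k} (s : Fin n)
    (inv_old : ∀ h, inv' (graftMap n (Sum.inl (Sum.inl h))) = graftMap n (Sum.inl (Sum.inl (inv h))))
    (inv_chord : ∀ b, inv' (graftMap n (Sum.inl (Sum.inr b))) = graftMap n (Sum.inl (Sum.inr !b)))
    (inv_new : ∀ b, inv' (graftMap n (Sum.inr b)) = graftMap n (Sum.inr !b))
    (next_old : ∀ h, h ≠ s →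
      next' (graftMap n (Sum.inl (Sum.inl h))) = graftMap n (Sum.inl (Sum.inl (next h))))
    (next_s : next' (graftMap n (Sum.inl (Sum.inl s))) = graftMap n (Sum.inl (Sum.inr false)))
    (next_chord : next' (graftMap n (Sum.inl (Sum.inr false))) = graftMap n (Sum.inr true))
    (next_new : next' (graftMap n (Sum.inr true)) = graftMap n (Sum.inl (Sum.inl s)))
    (next_chord_end : next' (graftMap n (Sum.inl (Sum.inr true))) =
      graftMap n (Sum.inl (Sum.inr true)))
    (next_new_end : next' (graftMap n (Sum.inr false)) = graftMap n (Sum.inr false))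
    (color_old : ∀ h, col' (graftMap n (Sum.inl (Sum.inl h))) = col h)
    (color_chord_end : col' (graftMap n (Sum.inl (Sum.inr true))) = m)
    (color_new_end : col' (graftMap n (Sum.inr false)) = col s) :
    Graft (UTDiagram.ofTable inv next h₁ h₂ h₃ col) s m
      (UTDiagram.ofTable inv' next' h₁' h₂' h₃' col') where
  e := Equiv.ofBijective (graftMap n) (graftMap_bijective n)
  inv_old := inv_old
  inv_chord := inv_chord
  inv_new := inv_new
  next_old := next_old
  next_s := next_s
  next_chord := next_chord
  next_new := next_new
  next_chord_end := next_chord_end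
  next_new_end := next_new_end
  color_old h _ _ _ := color_old h
  color_chord_end _ := color_chord_end
  color_new_end _ _ := color_new_end

/-- A chord with colours `i` and `j` at its ends. -/
abbrev chord (i j : Fin k) : UTDiagram k :=
  ofTable (n := 2) ![1, 0] ![0, 1] (by decide) (by decide) (by decide) ![i, j]

/-- The diagram with one trivalent vertex, whose neighbours have the colours `i`, `j`, `l` in
cyclic order. -/
abbrev tripod (i j l : Fin k) : UTDiagram k :=
  ofTable (n := 6) ![1, 0, 3, 2, 5, 4] ![2, 1, 4, 3, 0, 5] (by decide) (by decide) (by decide)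
    -- Only the entries at univalent half-edges are ever read. The filler color makes each table
    -- extend the previous one under `graftMap`.
    ![i, j, i, l, i, i]

/-- The tree with two trivalent vertices: half-edges that lead to the colours `a`, `b` follow the
inner edge at one of them, and `c`, `d` at the other. -/
abbrev quad (a b c d : Fin k) : UTDiagram k :=
  ofTable (n := 10) ![1, 0, 3, 2, 5, 4, 7, 6, 9, 8] ![2, 1, 4, 3, 0, 6, 8, 7, 5, 9]
    (by decide) (by decide) (by decide) ![d, a, d, b, d, d, d, c, d, d]

/-- The tree with three trivalent vertices, obtained by attaching the end with colour `i` of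
`quad a b c i` to a chord. -/
abbrev penta (a b c d i : Fin k) : UTDiagram k :=
  ofTable (n := 14) ![1, 0, 3, 2, 5, 4, 7, 6, 9, 8, 11, 10, 13, 12]
    ![2, 1, 4, 3, 0, 6, 8, 7, 5, 10, 12, 11, 9, 13]
    (by decide) (by decide) (by decide) ![i, a, i, b, i, i, i, c, i, i, i, d, i, i]

/-- Attaching a chord to another one gives a tripod. -/
noncomputable def graftChord (i j m : Fin k) :
    Graft (chord i j) (0 : Fin 2) m (tripod i j m) := by
  refine Graft.ofTable (n := 2) 0 ?_ ?_ ?_ ?_ ?_ ?_ ?_ ?_ ?_ ?_ ?_ ?_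
  on_goal 10 => intro h; fin_cases h <;> rfl
  on_goal 10 => rfl
  on_goal 10 => rfl
  all_goals decide

/-- Attaching a tripod to a chord gives a tree with two trivalent vertices. -/
noncomputable def graftTripod (i j l m : Fin k) :
    Graft (tripod i j l) (5 : Fin 6) m (quad j l m i) := by
  refine Graft.ofTable (n := 6) 5 ?_ ?_ ?_ ?_ ?_ ?_ ?_ ?_ ?_ ?_ ?_ ?_
  on_goal 10 => intro h; fin_cases h <;> rfl
  on_goal 10 => rfl
  on_goal 10 => rfl
  all_goals decide

/-- Attaching a tree with two trivalent vertices to a chord gives one with three of them. -/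
noncomputable def graftQuad (a b c i m : Fin k) :
    Graft (quad a b c i) (9 : Fin 10) m (penta a b c m i) := by
  refine Graft.ofTable (n := 10) 9 ?_ ?_ ?_ ?_ ?_ ?_ ?_ ?_ ?_ ?_ ?_ ?_
  on_goal 10 => intro h; fin_cases h <;> rfl
  on_goal 10 => rfl
  on_goal 10 => rfl
  all_goals decide

theorem rewire_isomorphic {T T' : UTDiagram k} (p : Equiv.Perm T.HalfEdge)
    (f : T.HalfEdge → T'.HalfEdge) (hf : Function.Bijective f)
    (hinv : ∀ h, f (p (T.inv h)) = T'.inv (f (p h))) (hnext : ∀ h, f (T.next h) = T'.next (f h))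
    (hcolor : ∀ h hD hE, T'.color (f h) hE = T.color h hD) : (T.rewire p).Isomorphic T' := by
  refine isomorphic_of_bijective f hf (fun h => ?_) hnext hcolor
  obtain ⟨h, rfl⟩ := p.surjective h
  rw [← hinv]
  exact congrArg (fun x => f (p (T.inv x))) (p.symm_apply_apply h)

theorem ofTable_rewire_isomorphic {n : ℕ} [NeZero n] {inv next : Fin n → Fin n}
    {h₁ : ∀ h, inv (inv h) = h} {h₂ : ∀ h, inv h ≠ h} {h₃ : ∀ h, next (next (next h)) = h}
    {col : Fin n → Fin k} {inv' next' : Fin n → Fin n} {h₁' : ∀ h, inv' (inv' h) = h}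
    {h₂' : ∀ h, inv' h ≠ h} {h₃' : ∀ h, next' (next' (next' h)) = h} {col' : Fin n → Fin k}
    (p : Equiv.Perm (Fin n)) (f g : Fin n → Fin n) (hfg : ∀ h, f (g h) = h)
    (hgf : ∀ h, g (f h) = h) (hinv : ∀ h, f (p (inv h)) = inv' (f (p h)))
    (hnext : ∀ h, f (next h) = next' (f h)) (hcolor : ∀ h, next h = h → col' (f h) = col h) :
    ((ofTable inv next h₁ h₂ h₃ col).rewire p).Isomorphic (ofTable inv' next' h₁' h₂' h₃' col') :=
  rewire_isomorphic (T := ofTable inv next h₁ h₂ h₃ col)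
    (T' := ofTable inv' next' h₁' h₂' h₃' col') p f (Equiv.bijective ⟨f, g, hgf, hfg⟩) hinv hnext
    fun h hD _ => hcolor h hD

theorem ofTable_isomorphic {n : ℕ} [NeZero n] {inv next : Fin n → Fin n}
    {h₁ : ∀ h, inv (inv h) = h} {h₂ : ∀ h, inv h ≠ h} {h₃ : ∀ h, next (next (next h)) = h}
    {col : Fin n → Fin k} {inv' next' : Fin n → Fin n} {h₁' : ∀ h, inv' (inv' h) = h}
    {h₂' : ∀ h, inv' h ≠ h} {h₃' : ∀ h, next' (next' (next' h)) = h} {col' : Fin n → Fin k}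
    (f g : Fin n → Fin n) (hfg : ∀ h, f (g h) = h) (hgf : ∀ h, g (f h) = h)
    (hinv : ∀ h, f (inv h) = inv' (f h)) (hnext : ∀ h, f (next h) = next' (f h))
    (hcolor : ∀ h, next h = h → col' (f h) = col h) :
    (ofTable inv next h₁ h₂ h₃ col).Isomorphic (ofTable inv' next' h₁' h₂' h₃' col') :=
  isomorphic_of_bijective (D := ofTable inv next h₁ h₂ h₃ col)
    (E := ofTable inv' next' h₁' h₂' h₃' col') f (Equiv.bijective ⟨f, g, hgf, hfg⟩) hinv hnext
    fun h hD _ => hcolor h hD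

/-! ### AS, IHX and isomorphisms for the small trees. -/

section Symmetries

variable (M : PreDiagram k) (φ : LinkHomotopySpace k →ₗ[ℂ] ℂ)

theorem gen_tripod_rotate (i j l : Fin k) :
    gen M φ (tripod i j l) = gen M φ (tripod j l i) := by
  apply gen_eq_of_isomorphic M φ
  refine ofTable_isomorphic ![4, 5, 0, 1, 2, 3] ![2, 3, 4, 5, 0, 1]
    (by decide) (by decide) (by decide) (by decide) ?_
  intro h
  fin_cases h <;> intro h <;> first | exact absurd h (by decide) | rfl

theorem gen_tripod_swap (i j l : Fin k) :
    gen M φ (tripod i j l) = - gen M φ (tripod i l j) := by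
  apply eq_neg_of_add_eq_zero_left
  refine gen_add_of_swap M φ (T := tripod i j l) (4 : Fin 6) (by decide : (0 : Fin 6) ≠ 4) ?_
  refine ofTable_rewire_isomorphic (Equiv.swap (0 : Fin 6) 2)
    ![0, 3, 2, 1, 4, 5] ![0, 3, 2, 1, 4, 5]
    (by decide) (by decide) (by decide) (by decide) ?_
  intro h
  fin_cases h <;> intro h <;> first | exact absurd h (by decide) | rfl

theorem gen_quad_flip (a b c d : Fin k) :
    gen M φ (quad a b c d) = gen M φ (quad c d a b) := by
  apply gen_eq_of_isomorphic M φ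
  refine ofTable_isomorphic ![6, 7, 8, 9, 5, 4, 0, 1, 2, 3] ![6, 7, 8, 9, 5, 4, 0, 1, 2, 3]
    (by decide) (by decide) (by decide) (by decide) ?_
  intro h
  fin_cases h <;> intro h <;> first | exact absurd h (by decide) | rfl

theorem gen_quad_swap (a b c d : Fin k) :
    gen M φ (quad a b c d) = - gen M φ (quad b a c d) := by
  apply eq_neg_of_add_eq_zero_left
  refine gen_add_of_swap M φ (T := quad a b c d) (4 : Fin 10) (by decide : (0 : Fin 10) ≠ 4) ?_
  refine ofTable_rewire_isomorphic (Equiv.swap (0 : Fin 10) 2)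
    ![0, 3, 2, 1, 4, 5, 6, 7, 8, 9] ![0, 3, 2, 1, 4, 5, 6, 7, 8, 9]
    (by decide) (by decide) (by decide) (by decide) ?_
  intro h
  fin_cases h <;> intro h <;> first | exact absurd h (by decide) | rfl

theorem gen_ofTable_ihx {n : ℕ} [NeZero n] {inv next : Fin n → Fin n}
    {h₁ : ∀ h, inv (inv h) = h} {h₂ : ∀ h, inv h ≠ h} {h₃ : ∀ h, next (next (next h)) = h}
    {col : Fin n → Fin k} {inv' next' : Fin n → Fin n} {h₁' : ∀ h, inv' (inv' h) = h}
    {h₂' : ∀ h, inv' h ≠ h} {h₃' : ∀ h, next' (next' (next' h)) = h} {col' : Fin n → Fin k}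
    {inv'' next'' : Fin n → Fin n} {h₁'' : ∀ h, inv'' (inv'' h) = h}
    {h₂'' : ∀ h, inv'' h ≠ h} {h₃'' : ∀ h, next'' (next'' (next'' h)) = h}
    {col'' : Fin n → Fin k} (h a b d : Fin n) (p : Fin n → Fin n)
    (hp : ∀ x, Equiv.swap a b (Equiv.swap b d x) = p x)
    (ha : a = next h) (hb : b = next a) (hd : d = next (inv h)) (h_tri : next h ≠ h)
    (h_tri' : next (inv h) ≠ inv h) (h_ne : inv h ≠ next h) (h_ne' : inv h ≠ next (next h))
    (f g : Fin n → Fin n) (hfg : ∀ h, f (g h) = h)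
    (hgf : ∀ h, g (f h) = h) (hinv : ∀ h, f (p (inv h)) = inv' (f (p h)))
    (hnext : ∀ h, f (next h) = next' (f h)) (hcolor : ∀ h, next h = h → col' (f h) = col h)
    (f' g' : Fin n → Fin n) (hfg' : ∀ h, f' (g' h) = h)
    (hgf' : ∀ h, g' (f' h) = h) (hinv' : ∀ h, f' (p (p (inv h))) = inv'' (f' (p (p h))))
    (hnext' : ∀ h, f' (next h) = next'' (f' h)) (hcolor' : ∀ h, next h = h → col'' (f' h) = col h) :
    gen M φ (ofTable inv next h₁ h₂ h₃ col) + gen M φ (ofTable inv' next' h₁' h₂' h₃' col') +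
      gen M φ (ofTable inv'' next'' h₁'' h₂'' h₃'' col'') = 0 := by
  obtain rfl : (fun x => Equiv.swap a b (Equiv.swap b d x)) = p := funext hp
  exact gen_ihx M φ (T := ofTable inv next h₁ h₂ h₃ col) h a b d ha hb hd h_tri h_tri' h_ne h_ne'
    (ofTable_rewire_isomorphic (Equiv.swap a b * Equiv.swap b d) f g hfg hgf hinv hnext hcolor)
    (ofTable_rewire_isomorphic ((Equiv.swap a b * Equiv.swap b d) ^ 2) f' g' hfg' hgf' hinv' hnext'
      hcolor')

theorem gen_quad_ihx (a b c d : Fin k) :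
    gen M φ (quad a b c d) + gen M φ (quad c a b d) + gen M φ (quad b c a d) = 0 := by
  -- The inner edge consists of 4 and 5, and the table is the 3-cycle of 0, 2, 6. The relabellings
  -- move the leaf halves 1, 3, 7 cyclically, which undoes the rewiring.
  refine gen_ofTable_ihx M φ 4 0 2 6 ![2, 1, 6, 3, 4, 5, 0, 7, 8, 9] (by decide)
    (by decide) (by decide) (by decide) (by decide) (by decide) (by decide) (by decide)
    ![0, 3, 2, 7, 4, 5, 6, 1, 8, 9] ![0, 7, 2, 1, 4, 5, 6, 3, 8, 9] (by decide) (by decide) (by decide)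
    (by decide) ?_ ![0, 7, 2, 1, 4, 5, 6, 3, 8, 9] ![0, 3, 2, 7, 4, 5, 6, 1, 8, 9] (by decide)
    (by decide) (by decide) (by decide) ?_ <;>
  · intro h
    fin_cases h <;> intro h <;> first | exact absurd h (by decide) | simp

end Symmetries

/-! ### Recognizing the tables inside a diagram. -/

section Table

variable {n : ℕ} [NeZero n] {inv next : Fin n → Fin n} {h₁ : ∀ h, inv (inv h) = h}
  {h₂ : ∀ h, inv h ≠ h} {h₃ : ∀ h, next (next (next h)) = h} {col : Fin n → Fin k}

/-- Connectedness is certified by the boundary walk from 0, which for a tree runs through all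
half-edges; bounding `m` by `n` makes this decidable. -/
theorem ofTable_hasRepeatedColor
    (hconn : ∀ x, ∃ m : Fin n, (fun y => next (inv y))^[m.1] 0 = x) {x y : Fin n}
    (hx : next x = x) (hy : next y = y) (hne : x ≠ y) (hcol : col x = col y) :
    (ofTable inv next h₁ h₂ h₃ col).HasRepeatedColor := by
  have key : ∀ m : ℕ, (ofTable inv next h₁ h₂ h₃ col).SameComponent (0 : Fin n)
      ((fun y => next (inv y))^[m] 0) := by
    intro m
    induction m with
    | zero => exact .refl _
    | succ m ih =>
      rw [Function.iterate_succ_apply']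
      exact (ih.trans (sameComponent_inv (D := ofTable inv next h₁ h₂ h₃ col) _)).trans
        (sameComponent_next (D := ofTable inv next h₁ h₂ h₃ col) _)
  obtain ⟨m, rfl⟩ := hconn x
  obtain ⟨m', rfl⟩ := hconn y
  exact ⟨_, _, hx, hy, hne, (key m).symm.trans (key m'), hcol⟩

/-- Pairwise diverging half-edges are distinct, so `f` is injective on leaves, hence injective. Thus
the tree really is a component of `D`. -/
theorem toSpace_eq_zero_of_ofTable {D : UTDiagram k} (hD : ¬ D.HasLoop) (f : Fin n → D.HalfEdge)
    (hinv : ∀ x, f (inv x) = D.inv (f x)) (hnext : ∀ x, f (next x) = D.next (f x))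
    (hwalk : ∀ x, ∃ m : Fin n, next ((fun y => next (inv y))^[m.1] x) =
      (fun y => next (inv y))^[m.1] x)
    (htri : ∀ x, next x ≠ x → D.next (f x) ≠ f x) (L : List D.HalfEdge)
    (hL : L.Pairwise D.Diverge) (l : Fin L.length → Fin n)
    (hl : ∀ x, next x = x → ∃ j, l j = x) (hf : ∀ j, f (l j) = D.inv (L.get j))
    (hcolor : ∀ x, next x = x → ∀ hx, D.color (f x) hx = col x)
    (hgen : ∀ M : PreDiagram k, M.ChordFree → ∀ φ, gen M φ (ofTable inv next h₁ h₂ h₃ col) = 0) :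
    D.toSpace = 0 := by
  refine toSpace_eq_zero_of_embedding (E := ofTable inv next h₁ h₂ h₃ col) f
    (injective_of_injective_on_leaves (E := ofTable inv next h₁ h₂ h₃ col) f hinv hnext
      (fun x => ?_) (fun x hx => ?_) fun x y hx hy h => ?_) hinv hnext
    (fun x hE hD => hcolor x hE hD) hgen
  · obtain ⟨m, hm⟩ := hwalk x
    exact ⟨m, hm⟩
  · by_contra h
    exact htri x h hx
  · obtain ⟨i, rfl⟩ := hl x hx
    obtain ⟨j, rfl⟩ := hl y hy
    rw [hf, hf] at h
    have h' := D.inv.injective h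
    rcases lt_trichotomy i j with hij | rfl | hij
    · exact absurd h' ((List.pairwise_iff_get.1 hL i j hij).ne hD)
    · rfl
    · exact absurd h'.symm ((List.pairwise_iff_get.1 hL j i hij).ne hD)

end Table

section Diverge

variable {D : UTDiagram k}

theorem diverge_next {v : D.HalfEdge} (h : D.next v ≠ v) : D.Diverge v (D.next v) :=
  .single (walkStep_inv_next h)

theorem diverge_next_next {v : D.HalfEdge} (h : D.next v ≠ v) :
    D.Diverge v (D.next (D.next v)) :=
  .single (walkStep_inv_next_next h)

theorem next_next_next_ne {v : D.HalfEdge} (h : D.next v ≠ v) :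
    D.next (D.next (D.next v)) ≠ D.next (D.next v) :=
  next_next_ne_next (next_next_ne_next h)

theorem pairwise_diverge_tripod {h : D.HalfEdge} (h₁ : D.next h ≠ h) :
    [D.next h, D.next (D.next h), h].Pairwise D.Diverge := by
  simp only [List.pairwise_cons, List.mem_cons, List.not_mem_nil, or_false, forall_eq_or_imp,
    forall_eq, List.Pairwise.nil, and_true, false_implies, implies_true]
  exact ⟨⟨diverge_next (next_next_ne_next h₁), (diverge_next h₁).symm⟩,
    (diverge_next_next h₁).symm⟩

theorem pairwise_diverge_quad {h : D.HalfEdge} (h₁ : D.next h ≠ h)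
    (h₂ : D.next (D.inv h) ≠ D.inv h) :
    [D.next h, D.next (D.next h), D.next (D.inv h), D.next (D.next (D.inv h))].Pairwise
      D.Diverge := by
  simp only [List.pairwise_cons, List.mem_cons, List.not_mem_nil, or_false, forall_eq_or_imp,
    forall_eq, List.Pairwise.nil, and_true, false_implies, implies_true]
  have s1 := walkStep_next h₂
  have s2 := walkStep_next_next h₂
  have d1 := (diverge_next h₁).symm
  have d2 := (diverge_next_next h₁).symm
  exact ⟨⟨diverge_next (next_next_ne_next h₁), d1.step s1, d1.step s2⟩,
    ⟨d2.step s1, d2.step s2⟩, diverge_next (next_next_ne_next h₂)⟩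

/-- The vertex of `s` is the middle one of three trivalent vertices in a row; the list consists of
the five half-edges that point outwards. -/
theorem pairwise_diverge_penta {s : D.HalfEdge} (h₁ : D.next s ≠ s)
    (h₂ : D.next (D.inv s) ≠ D.inv s)
    (h₃ : D.next (D.inv (D.next s)) ≠ D.inv (D.next s)) :
    [D.next (D.inv (D.next s)), D.next (D.next (D.inv (D.next s))), D.next (D.next s),
      D.next (D.inv s), D.next (D.next (D.inv s))].Pairwise D.Diverge := by
  simp only [List.pairwise_cons, List.mem_cons, List.not_mem_nil, or_false, forall_eq_or_imp,
    forall_eq, List.Pairwise.nil, and_true, false_implies, implies_true]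
  have s1 := walkStep_next h₂
  have s2 := walkStep_next_next h₂
  have x1 := walkStep_next h₃
  have x2 := walkStep_next_next h₃
  have ys := (diverge_next_next h₁).symm
  have yx := (diverge_next (next_next_ne_next h₁)).symm
  have xs := (diverge_next h₁).symm
  have sx1 := (xs.step s1).symm
  have sx2 := (xs.step s2).symm
  exact ⟨⟨diverge_next (next_next_ne_next h₃), (yx.step x1).symm, (sx1.step x1).symm,
      (sx2.step x1).symm⟩,
    ⟨(yx.step x2).symm, (sx1.step x2).symm, (sx2.step x2).symm⟩, ⟨ys.step s1, ys.step s2⟩,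
    diverge_next (next_next_ne_next h₂)⟩

end Diverge

/-! ### Trees with coinciding colors. -/

section Repeated

variable (M : PreDiagram k) (φ : LinkHomotopySpace k →ₗ[ℂ] ℂ)

theorem gen_tripod_eq_zero_of_eq {i j l : Fin k} (h : i = j ∨ i = l ∨ j = l) :
    gen M φ (tripod i j l) = 0 := by
  apply gen_eq_zero_of_hasRepeatedColor
  rcases h with rfl | rfl | rfl
  · exact ofTable_hasRepeatedColor (x := 5) (y := 1) (by decide) (by decide) (by decide)
      (by decide) rfl
  · exact ofTable_hasRepeatedColor (x := 5) (y := 3) (by decide) (by decide) (by decide)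
      (by decide) rfl
  · exact ofTable_hasRepeatedColor (x := 1) (y := 3) (by decide) (by decide) (by decide)
      (by decide) rfl

theorem gen_quad_eq_zero_of_eq {a b c d : Fin k}
    (h : a = b ∨ a = c ∨ a = d ∨ b = c ∨ b = d ∨ c = d) : gen M φ (quad a b c d) = 0 := by
  have key : ∀ x : Fin 10, ∃ m : Fin 10, (fun y => (![2, 1, 4, 3, 0, 6, 8, 7, 5, 9] :
      Fin 10 → Fin 10) ((![1, 0, 3, 2, 5, 4, 7, 6, 9, 8] : Fin 10 → Fin 10) y))^[m.1] 0 = x := by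
    decide
  apply gen_eq_zero_of_hasRepeatedColor
  rcases h with h | h | h | h | h | h
  · exact ofTable_hasRepeatedColor (x := 1) (y := 3) key (by decide) (by decide) (by decide) h
  · exact ofTable_hasRepeatedColor (x := 1) (y := 7) key (by decide) (by decide) (by decide) h
  · exact ofTable_hasRepeatedColor (x := 1) (y := 9) key (by decide) (by decide) (by decide) h
  · exact ofTable_hasRepeatedColor (x := 3) (y := 7) key (by decide) (by decide) (by decide) h
  · exact ofTable_hasRepeatedColor (x := 3) (y := 9) key (by decide) (by decide) (by decide) h
  · exact ofTable_hasRepeatedColor (x := 7) (y := 9) key (by decide) (by decide) (by decide) h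

theorem gen_penta_eq_zero_of_eq {a b c d i : Fin k}
    (h : (a = b ∨ a = c ∨ a = i ∨ b = c ∨ b = i ∨ c = i) ∨ a = d ∨ b = d ∨ c = d ∨ i = d) :
    gen M φ (penta a b c d i) = 0 := by
  have key : ∀ x : Fin 14, ∃ m : Fin 14,
      (fun y => (![2, 1, 4, 3, 0, 6, 8, 7, 5, 10, 12, 11, 9, 13] : Fin 14 → Fin 14)
        ((![1, 0, 3, 2, 5, 4, 7, 6, 9, 8, 11, 10, 13, 12] : Fin 14 → Fin 14) y))^[m.1] 0 = x := by
    decide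
  apply gen_eq_zero_of_hasRepeatedColor
  rcases h with (h | h | h | h | h | h) | h | h | h | h
  · exact ofTable_hasRepeatedColor (x := 1) (y := 3) key (by decide) (by decide) (by decide) h
  · exact ofTable_hasRepeatedColor (x := 1) (y := 7) key (by decide) (by decide) (by decide) h
  · exact ofTable_hasRepeatedColor (x := 1) (y := 13) key (by decide) (by decide) (by decide) h
  · exact ofTable_hasRepeatedColor (x := 3) (y := 7) key (by decide) (by decide) (by decide) h
  · exact ofTable_hasRepeatedColor (x := 3) (y := 13) key (by decide) (by decide) (by decide) h
  · exact ofTable_hasRepeatedColor (x := 7) (y := 13) key (by decide) (by decide) (by decide) h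
  · exact ofTable_hasRepeatedColor (x := 1) (y := 11) key (by decide) (by decide) (by decide) h
  · exact ofTable_hasRepeatedColor (x := 3) (y := 11) key (by decide) (by decide) (by decide) h
  · exact ofTable_hasRepeatedColor (x := 7) (y := 11) key (by decide) (by decide) (by decide) h
  · exact ofTable_hasRepeatedColor (x := 13) (y := 11) key (by decide) (by decide) (by decide) h

end Repeated

/-! ### The linear systems. -/

section Algebra

theorem chordVar_comm (i j : Fin k) : chordVar i j = chordVar j i :=
  add_comm _ _

theorem chordVar_eq_coe (i j : Fin k) : chordVar i j =
    MvPolynomial.coeToMvPowerSeries.ringHom (R := ℂ)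
      (MvPolynomial.X (i, j) + MvPolynomial.X (j, i)) := by
  rw [map_add]
  simp [chordVar]

/-- Power series cannot be evaluated at arbitrary points, but the determinants are polynomials, so
one value certifies that they do not vanish. -/
theorem coe_ne_zero_of_eval {P : MvPolynomial (Fin k × Fin k) ℂ} (v : Fin k × Fin k → ℂ)
    (h : MvPolynomial.eval v P ≠ 0) : MvPolynomial.coeToMvPowerSeries.ringHom P ≠ 0 := by
  intro e
  refine h ?_
  have : P = 0 := MvPolynomial.coe_injective _ _ (by simpa using e)
  rw [this, map_zero]

theorem chordVar_ne_zero (i j : Fin k) : chordVar i j ≠ 0 := by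
  rw [chordVar_eq_coe]
  apply coe_ne_zero_of_eval fun _ => 1
  simp

theorem eq_of_five_distinct {a b c d e : Fin 5} (h : [a, b, c, d, e].Nodup) (x : Fin 5) :
    x = a ∨ x = b ∨ x = c ∨ x = d ∨ x = e := by
  have h1 : [a, b, c, d, e].toFinset = Finset.univ := by
    rw [← Finset.card_eq_iff_eq_univ, List.toFinset_card_of_nodup h]
    rfl
  have := Finset.mem_univ x
  rw [← h1] at this
  simpa using this

theorem quad_system {R : Type*} [CommRing R] [NoZeroDivisors R] (x : Fin 5 → Fin 5 → R)
    (hx : ∀ i j, x i j = x j i) (g : Fin 5 → Fin 5 → Fin 5 → Fin 5 → R)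
    (hswap : ∀ a b c d, g a b c d = - g b a c d) (hflip : ∀ a b c d, g a b c d = g c d a b)
    (hihx : ∀ a b c d, g a b c d + g c a b d + g b c a d = 0)
    (hlink : ∀ i j l m n, [i, j, l, m, n].Nodup → x i m * g j l m i + x i n * g j l n i = 0)
    {a b c d e : Fin 5} (hne : [a, b, c, d, e].Nodup)
    (hP : (x b c * x a d) * (x c a * x b d) + (x a b * x c d) * (x c a * x b d) +
      (x a b * x c d) * (x b c * x a d) ≠ 0) : g a b c d = 0 := by
  -- The link relation at the leaf `b` trades the color `a` for the missing color `e`.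
  have hcyc : ∀ a b c d e, [a, b, c, d, e].Nodup → x a b * g a b c d = x b e * g b e c d := by
    intro a b c d e h
    have h' : [b, c, d, a, e].Nodup := by simp at h ⊢; tauto
    have := hlink b c d a e h'
    rw [hflip c d a b, hflip c d e b, hswap e b, hx b a] at this
    linear_combination this
  -- Four trades lead from `abcd` through `becd`, `beda`, `ecda` to `bcad`; the factors involving
  -- `e` cancel along the way.
  have hQ : ∀ a b c d e, [a, b, c, d, e].Nodup →
      x a b * x c d * g a b c d = x b c * x a d * g b c a d := by
    intro a b c d e h
    have e1 := hcyc a b c d e h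
    have e2 := hcyc c d b e a (by simp at h ⊢; tauto)
    have e3 := hcyc b e d a c (by simp at h ⊢; tauto)
    have e4 := hcyc e c d a b (by simp at h ⊢; tauto)
    rw [hflip c d b e, hflip d a b e] at e2
    have e5 : g c b d a = g b c a d := by
      rw [hswap, hflip, hswap, hflip, neg_neg]
    rw [e5] at e4
    rw [hx d a] at e2
    rw [hx c b] at e4
    linear_combination x c d * e1 + x b e * e2 + x a d * e3 + x a d * e4
  have q1 := hQ a b c d e hne
  have q2 := hQ b c a d e (by simp at hne ⊢; tauto)
  have := hihx a b c d
  refine (mul_eq_zero.1 ?_).resolve_left hP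
  -- With `Q` the common value, IHX says that `Q` times the sum of the inverses of the three
  -- products is zero; `hP` is that sum with denominators cleared.
  linear_combination (x b c * x a d) * (x c a * x b d) * this +
    (x c a * x b d) * q1 + (x b c * x a d) * (q1 + q2)

theorem tripod_system {R : Type*} [CommRing R] [NoZeroDivisors R] (x : Fin 5 → Fin 5 → R)
    (hx : ∀ i j, x i j = x j i) (y : Fin 5 → Fin 5 → Fin 5 → R)
    (hswap : ∀ i j l, y i j l = - y i l j) (hrot : ∀ i j l, y i j l = y j l i)
    (hlink : ∀ i j l m n, [i, j, l, m, n].Nodup →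
      x i l * y i j l + x i m * y i j m + x i n * y i j n = 0)
    {a b c d e : Fin 5} (hne : [a, b, c, d, e].Nodup)
    (hP : (x a c * x b e - x a e * x b c) * (x a b * x d e - x a e * x b d) *
        (x a d * x c e - x a e * x c d) -
      (x a b * x c e - x a e * x b c) * (x a c * x d e - x a e * x c d) *
        (x a d * x b e - x a e * x b d) ≠ 0) : y a b c = 0 := by
  -- Eliminate `y a b e` from the link relations at the two ends of the chord with colors `a`, `b`.
  have hK : ∀ a b c d e, [a, b, c, d, e].Nodup →
      y a b c * (x a c * x b e - x a e * x b c) = - y a b d * (x a d * x b e - x a e * x b d) := by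
    intro a b c d e h
    have e1 := hlink a b c d e h
    have e2 := hlink b a c d e (by simp at h ⊢; tauto)
    have hs : ∀ l, y b a l = - y a b l := fun l => by rw [hrot, hswap]
    rw [hs, hs, hs] at e2
    linear_combination x b e * e1 + x a e * e2
  have k1 := hK a b c d e hne
  have k2 := hK a c d b e (by simp at hne ⊢; tauto)
  have k3 := hK a d b c e (by simp at hne ⊢; tauto)
  rw [hswap a c b, hx c b] at k2
  rw [hswap a d b, hswap a d c, hx d b, hx d c] at k3
  refine (mul_eq_zero.1 ?_).resolve_left hP
  -- Three equations in `y a b c`, `y a b d`, `y a c d`, whose determinant is the expression in `hP`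
  -- up to sign.
  linear_combination (x a b * x d e - x a e * x b d) * (x a d * x c e - x a e * x c d) * k1 +
    (x a d * x b e - x a e * x b d) * (x a d * x c e - x a e * x c d) * k3 +
    (x a c * x d e - x a e * x c d) * (x a d * x b e - x a e * x b d) * k2

end Algebra

/-! ### Descending elimination of trees on five colors. -/

section Attach

variable {k : ℕ} {D : UTDiagram k} {s x : D.HalfEdge} {hs : D.next s = s} {hx : D.next x = x}
  {hne : x ≠ s}

theorem attach_next_of_ne {h : D.HalfEdge} (hh : D.next h ≠ h) :
    (D.attach s x hs hx hne).next (Sum.inl h) = Sum.inl (D.next h) :=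
  D.attachNext_of_ne (fun e => hh (by rw [e, hs])) (fun e => hh (by rw [e, hx]))

theorem attach_next_ne {h : D.HalfEdge} (hh : D.next h ≠ h) :
    (D.attach s x hs hx hne).next (Sum.inl h) ≠ Sum.inl h := by
  rw [attach_next_of_ne hh]
  exact fun e => hh (Sum.inl.inj e)

theorem attach_next_s : (D.attach s x hs hx hne).next (Sum.inl s) = Sum.inl x :=
  D.attachNext_s hx hne

theorem attach_next_s_ne : (D.attach s x hs hx hne).next (Sum.inl s) ≠ Sum.inl s := by
  rw [attach_next_s]
  exact fun e => hne (Sum.inl.inj e)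

theorem attach_next_x_ne : (D.attach s x hs hx hne).next (Sum.inl x) ≠ Sum.inl x := by
  have : (D.attach s x hs hx hne).next (Sum.inl x) = Sum.inr true := D.attachNext_x s x
  rw [this]
  exact Sum.inr_ne_inl

theorem attach_next_inv_next_s_ne (h : D.next (D.inv x) ≠ D.inv x) :
    (D.attach s x hs hx hne).next ((D.attach s x hs hx hne).inv
      ((D.attach s x hs hx hne).next (Sum.inl s))) ≠
      (D.attach s x hs hx hne).inv ((D.attach s x hs hx hne).next (Sum.inl s)) := by
  rw [attach_next_s]
  exact attach_next_ne h

end Attach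

variable {D : UTDiagram 5}

/-- Five half-edges point outwards already; one that does not end in a leaf produces a sixth leaf,
too many for five colors. -/
theorem toSpace_eq_zero_of_four_trivalent {s : D.HalfEdge} (h₁ : D.next s ≠ s)
    (h₂ : D.next (D.inv s) ≠ D.inv s) (h₃ : D.next (D.inv (D.next s)) ≠ D.inv (D.next s))
    {a : D.HalfEdge} (ha : a ∈ [D.next (D.inv (D.next s)), D.next (D.next (D.inv (D.next s))),
      D.next (D.next s), D.next (D.inv s), D.next (D.next (D.inv s))])
    (hne : D.next (D.inv a) ≠ D.inv a) : D.toSpace = 0 := by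
  by_cases hD : D.HasLoop
  · exact toSpace_eq_zero_of_hasLoop hD
  · exact toSpace_eq_zero_of_hasRepeatedColor (hasRepeatedColor_of_diverge_of_ne hD _
      (pairwise_diverge_penta h₁ h₂ h₃) le_rfl ha hne)

theorem gen_penta_eq_zero {M : PreDiagram 5} (hM : M.ChordFree)
    (φ : LinkHomotopySpace 5 →ₗ[ℂ] ℂ) (a b c d i : Fin 5) : gen M φ (penta a b c d i) = 0 := by
  by_cases h1 : (a = b ∨ a = c ∨ a = i ∨ b = c ∨ b = i ∨ c = i) ∨ a = d ∨ b = d ∨ c = d ∨ i = d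
  · exact gen_penta_eq_zero_of_eq M φ h1
  · have h2 := sum_chordVar_mul_gen_graft M φ (t := quad a b c i) (s := (9 : Fin 10)) rfl
      (fun m => graftQuad a b c i m) ?_ ?_
    · rw [Finset.sum_eq_single d] at h2
      · exact (mul_eq_zero.1 h2).resolve_left (chordVar_ne_zero _ _)
      · intro m _ hm
        have h3 := eq_of_five_distinct (a := a) (b := b) (c := c) (d := i) (e := d)
          (by simp; tauto) m
        rw [gen_penta_eq_zero_of_eq M φ, mul_zero]
        tauto
      · simp
    · intro (x : Fin 10)
      change (![2, 1, 4, 3, 0, 6, 8, 7, 5, 9] : Fin 10 → Fin 10) x = x →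
        (![i, a, i, b, i, i, i, c, i, i] : Fin 10 → Fin 5) x = i → x = 9
      push Not at h1
      fin_cases x <;> simp [h1]
    · intro e x
      refine attachTerm_eq_zero (D := withChords (quad a b c i) M e) _ fun hx hne _ => ?_
      have hx' := hM x (Sum.inr.inj (Sum.inr.inj hx))
      -- The merged vertex lies between a trivalent vertex of `quad` and, since `M` has no chords,
      -- one of `M`; the half-edge 5 leads to the other vertex of `quad`, the fourth.
      refine toSpace_eq_zero_of_four_trivalent (s := Sum.inl (Sum.inl (9 : Fin 10)))
        attach_next_s_ne ?_ ?_ (a := Sum.inl (Sum.inl (5 : Fin 10))) ?_ ?_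
      · exact attach_next_ne (D := withChords (quad a b c i) M e)
          (h := Sum.inl (8 : Fin 10)) (fun e =>
            absurd (Sum.inl.inj e) (by decide : (5 : Fin 10) ≠ 8))
      · exact attach_next_inv_next_s_ne (D := withChords (quad a b c i) M e)
          fun e => hx' (Sum.inr.inj (Sum.inr.inj e))
      · have : ((withChords (quad a b c i) M e).attach _ _ rfl hx hne).next
            (Sum.inl (Sum.inl (8 : Fin 10))) = Sum.inl (Sum.inl (5 : Fin 10)) :=
          attach_next_of_ne (D := withChords (quad a b c i) M e)
            (h := Sum.inl (8 : Fin 10))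
            (fun e =>
              absurd (Sum.inl.inj e) (by decide : (5 : Fin 10) ≠ 8))
        exact List.mem_cons_of_mem _ (List.mem_cons_of_mem _ (List.mem_cons_of_mem _
          (List.mem_cons.2 (Or.inl this.symm))))
      · exact attach_next_ne (D := withChords (quad a b c i) M e)
          (h := Sum.inl (4 : Fin 10)) (fun e =>
            absurd (Sum.inl.inj e) (by decide : (0 : Fin 10) ≠ 4))

theorem toSpace_eq_zero_of_three_trivalent {s : D.HalfEdge} (h₁ : D.next s ≠ s)
    (h₂ : D.next (D.inv s) ≠ D.inv s) (h₃ : D.next (D.inv (D.next s)) ≠ D.inv (D.next s)) :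
    D.toSpace = 0 := by
  by_contra h0
  have hD : ¬ D.HasLoop := fun h => h0 (toSpace_eq_zero_of_hasLoop h)
  have hleaf : ∀ a ∈ [D.next (D.inv (D.next s)), D.next (D.next (D.inv (D.next s))),
      D.next (D.next s), D.next (D.inv s), D.next (D.next (D.inv s))],
      D.next (D.inv a) = D.inv a := by
    intro a ha
    by_contra hne
    exact h0 (toSpace_eq_zero_of_four_trivalent h₁ h₂ h₃ ha hne)
  have hp := pairwise_diverge_penta h₁ h₂ h₃
  simp only [List.mem_cons, List.not_mem_nil, or_false, forall_eq_or_imp, forall_eq] at hleaf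
  obtain ⟨l1, l2, l3, l4, l5⟩ := hleaf
  refine h0 (toSpace_eq_zero_of_ofTable hD
    (![D.next (D.inv (D.next s)), D.inv (D.next (D.inv (D.next s))),
      D.next (D.next (D.inv (D.next s))), D.inv (D.next (D.next (D.inv (D.next s)))),
      D.inv (D.next s), D.next s, D.next (D.next s), D.inv (D.next (D.next s)), s, D.inv s,
      D.next (D.inv s), D.inv (D.next (D.inv s)), D.next (D.next (D.inv s)),
      D.inv (D.next (D.next (D.inv s)))]) ?_ ?_ (by decide) ?_ _ hp ![1, 3, 7, 11, 13]
    (by exact (by decide : ∀ x : Fin 14,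
      (![2, 1, 4, 3, 0, 6, 8, 7, 5, 10, 12, 11, 9, 13] : Fin 14 → Fin 14) x = x →
        ∃ j : Fin 5, ![1, 3, 7, 11, 13] j = x)) ?_ ?_ (fun M hM φ => gen_penta_eq_zero hM φ (D.color _ l1) (D.color _ l2)
      (D.color _ l3) (D.color _ l4) (D.color _ l5)))
  · intro x; fin_cases x <;> simp [D.inv_inv]
  · intro x; fin_cases x <;> simp [D.next_next_next, l1, l2, l3, l4, l5]
  · intro x
    have := next_next_ne_next h₁
    have := next_next_ne_next h₂
    have := next_next_ne_next h₃
    have := next_next_next_ne h₁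
    have := next_next_next_ne h₂
    have := next_next_next_ne h₃
    fin_cases x <;> simp [*]
  · intro j
    change Fin 5 at j
    fin_cases j <;> rfl
  · intro x
    fin_cases x <;> intro h <;> first | exact absurd h (by decide) | exact fun _ => rfl

theorem gen_quad_eq_zero {M : PreDiagram 5} (hM : M.ChordFree)
    (φ : LinkHomotopySpace 5 →ₗ[ℂ] ℂ) {a b c d e : Fin 5} (hne : [a, b, c, d, e].Nodup) :
    gen M φ (quad a b c d) = 0 := by
  refine quad_system chordVar chordVar_comm (fun a b c d => gen M φ (quad a b c d))
    (gen_quad_swap M φ) (gen_quad_flip M φ) (gen_quad_ihx M φ) ?_ hne ?_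
  · intro i j l m n h
    have h2 := sum_chordVar_mul_gen_graft M φ (t := tripod i j l) (s := (5 : Fin 6)) rfl
      (fun m => graftTripod i j l m) ?_ ?_
    · rw [← Finset.sum_subset (Finset.subset_univ {m, n}), Finset.sum_pair] at h2
      · exact h2
      · simp at h; tauto
      · intro p _ hp
        have h3 := eq_of_five_distinct h p
        rw [gen_quad_eq_zero_of_eq M φ, mul_zero]
        simp at hp
        tauto
    · intro (x : Fin 6)
      change (![2, 1, 4, 3, 0, 5] : Fin 6 → Fin 6) x = x →
        (![i, j, i, l, i, i] : Fin 6 → Fin 5) x = i → x = 5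
      have h3 : j ≠ i ∧ l ≠ i := by
        simp at h
        exact ⟨fun e => h.1.1 e.symm, fun e => h.1.2.1 e.symm⟩
      fin_cases x <;> simp [h3]
    · intro f x
      refine attachTerm_eq_zero (D := withChords (tripod i j l) M f) _ fun hx hne _ => ?_
      have hx' := hM x (Sum.inr.inj (Sum.inr.inj hx))
      -- The vertex of the tripod, the merged vertex and the neighbor of `x` in `M` form a row of
      -- three.
      refine toSpace_eq_zero_of_three_trivalent (s := Sum.inl (Sum.inl (5 : Fin 6)))
        attach_next_s_ne ?_ ?_
      · exact attach_next_ne (D := withChords (tripod i j l) M f)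
          (h := Sum.inl (4 : Fin 6)) (fun e =>
            absurd (Sum.inl.inj e) (by decide : (0 : Fin 6) ≠ 4))
      · exact attach_next_inv_next_s_ne (D := withChords (tripod i j l) M f)
          fun e => hx' (Sum.inr.inj (Sum.inr.inj e))
  · simp only [chordVar_eq_coe, ← map_mul, ← map_add]
    -- Every `chordVar` takes the value 2 here, so the three summands cannot cancel.
    apply coe_ne_zero_of_eval fun _ => 1
    simp
    norm_num

theorem exists_nodup_append {n : ℕ} {L : List (Fin n)} (h : L.Nodup) (hL : L.length < n) :
    ∃ e, (L ++ [e]).Nodup := by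
  obtain ⟨e, he⟩ : ∃ e, e ∉ L.toFinset := by
    by_contra! h'
    have := Finset.card_le_card (fun x _ => h' x : (Finset.univ : Finset (Fin n)) ⊆ _)
    rw [List.toFinset_card_of_nodup h, Finset.card_univ, Fintype.card_fin] at this
    omega
  refine ⟨e, h.append (List.nodup_singleton e) ?_⟩
  simpa using he

theorem toSpace_eq_zero_of_two_trivalent {h : D.HalfEdge} (h₁ : D.next h ≠ h)
    (h₂ : D.next (D.inv h) ≠ D.inv h) : D.toSpace = 0 := by
  by_contra h0
  have hD : ¬ D.HasLoop := fun h => h0 (toSpace_eq_zero_of_hasLoop h)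
  have l1 : D.next (D.inv (D.next h)) = D.inv (D.next h) := by
    by_contra hne
    exact h0 (toSpace_eq_zero_of_three_trivalent h₁ h₂ hne)
  have l2 : D.next (D.inv (D.next (D.next h))) = D.inv (D.next (D.next h)) := by
    by_contra hne
    refine h0 (toSpace_eq_zero_of_three_trivalent (next_next_next_ne h₁) hne ?_)
    rwa [D.next_next_next]
  have l3 : D.next (D.inv (D.next (D.inv h))) = D.inv (D.next (D.inv h)) := by
    by_contra hne
    exact h0 (toSpace_eq_zero_of_three_trivalent h₂ (by rwa [D.inv_inv]) hne)
  have l4 : D.next (D.inv (D.next (D.next (D.inv h)))) = D.inv (D.next (D.next (D.inv h))) := by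
    by_contra hne
    refine h0 (toSpace_eq_zero_of_three_trivalent (next_next_next_ne h₂) hne ?_)
    rwa [D.next_next_next, D.inv_inv]
  refine h0 (toSpace_eq_zero_of_ofTable hD
    (![D.next h, D.inv (D.next h), D.next (D.next h), D.inv (D.next (D.next h)), h, D.inv h,
      D.next (D.inv h), D.inv (D.next (D.inv h)), D.next (D.next (D.inv h)),
      D.inv (D.next (D.next (D.inv h)))]) ?_ ?_ (by decide) ?_ _ (pairwise_diverge_quad h₁ h₂)
    ![1, 3, 7, 9]
    (by exact (by decide : ∀ x : Fin 10,
      (![2, 1, 4, 3, 0, 6, 8, 7, 5, 9] : Fin 10 → Fin 10) x = x →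
        ∃ j : Fin 4, ![1, 3, 7, 9] j = x)) ?_ ?_ (fun M hM φ => ?_ :
          ∀ M : PreDiagram 5, M.ChordFree → ∀ φ, gen M φ (quad (D.color _ l1) (D.color _ l2)
            (D.color _ l3) (D.color _ l4)) = 0))
  · intro x; fin_cases x <;> simp [D.inv_inv]
  · intro x; fin_cases x <;> simp [D.next_next_next, l1, l2, l3, l4]
  · intro x
    have := next_next_ne_next h₁
    have := next_next_ne_next h₂
    have := next_next_next_ne h₁
    have := next_next_next_ne h₂
    fin_cases x <;> simp [*]
  · intro j
    change Fin 4 at j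
    fin_cases j <;> rfl
  · intro x
    fin_cases x <;> intro h <;> first | exact absurd h (by decide) | exact fun _ => rfl
  · by_cases hc : [D.color _ l1, D.color _ l2, D.color _ l3, D.color _ l4].Nodup
    · obtain ⟨e, he⟩ := exists_nodup_append hc (by simp)
      exact gen_quad_eq_zero hM φ he
    · apply gen_quad_eq_zero_of_eq
      simp at hc
      tauto

theorem gen_tripod_eq_zero {M : PreDiagram 5} (hM : M.ChordFree)
    (φ : LinkHomotopySpace 5 →ₗ[ℂ] ℂ) {a b c d e : Fin 5} (hne : [a, b, c, d, e].Nodup) :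
    gen M φ (tripod a b c) = 0 := by
  refine tripod_system chordVar chordVar_comm (fun a b c => gen M φ (tripod a b c))
    (gen_tripod_swap M φ) (gen_tripod_rotate M φ) ?_ hne ?_
  · intro i j l m n h
    have h2 := sum_chordVar_mul_gen_graft M φ (t := chord i j) (s := (0 : Fin 2)) rfl
      (fun m => graftChord i j m) ?_ ?_
    · rw [← Finset.sum_subset (Finset.subset_univ {l, m, n}), Finset.sum_insert,
        Finset.sum_pair, ← add_assoc] at h2
      · exact h2
      · simp at h; tauto
      · simp at h ⊢; tauto
      · intro p _ hp
        have h3 := eq_of_five_distinct h p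
        rw [gen_tripod_eq_zero_of_eq M φ, mul_zero]
        simp at hp
        tauto
    · intro (x : Fin 2)
      change (![0, 1] : Fin 2 → Fin 2) x = x → (![i, j] : Fin 2 → Fin 5) x = i → x = 0
      have h3 : j ≠ i := by
        simp at h
        exact fun e => h.1.1 e.symm
      fin_cases x <;> simp [h3]
    · intro f x
      refine attachTerm_eq_zero (D := withChords (chord i j) M f) _ fun hx hne _ => ?_
      have hx' := hM x (Sum.inr.inj (Sum.inr.inj hx))
      refine toSpace_eq_zero_of_two_trivalent (h := Sum.inl (Sum.inr (Sum.inr x)))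
        attach_next_x_ne ?_
      exact attach_next_ne (D := withChords (chord i j) M f)
          (h := Sum.inr (Sum.inr (M.inv x))) fun e => hx' (Sum.inr.inj (Sum.inr.inj e))
  · simp only [chordVar_eq_coe, ← map_mul, ← map_sub]
    -- At a constant point every factor of the determinant is zero. This choice makes the variables
    -- of `bc`, `bd`, `ce` vanish and the others 1: the second product dies and the first is -1.
    apply coe_ne_zero_of_eval fun p =>
      if p ∈ [(a, b), (a, c), (a, d), (a, e), (c, d), (b, e), (d, e)] then 1 else 0
    simp at hne
    simp [hne, eq_comm]

/-- By the previous stage no two trivalent vertices are adjacent, so the component is a tripod. -/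
theorem toSpace_eq_zero_of_trivalent {h : D.HalfEdge} (h₁ : D.next h ≠ h) : D.toSpace = 0 := by
  by_contra h0
  have hD : ¬ D.HasLoop := fun h => h0 (toSpace_eq_zero_of_hasLoop h)
  have key : ∀ x, D.next x ≠ x → D.next (D.inv x) = D.inv x := by
    intro x hx
    by_contra hne
    exact h0 (toSpace_eq_zero_of_two_trivalent hx hne)
  have l1 := key _ (next_next_ne_next h₁)
  have l2 := key _ (next_next_next_ne h₁)
  have l3 := key _ h₁
  refine h0 (toSpace_eq_zero_of_ofTable hD
    (![D.next h, D.inv (D.next h), D.next (D.next h), D.inv (D.next (D.next h)), h, D.inv h])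
    ?_ ?_ (by decide) ?_ _ (pairwise_diverge_tripod h₁) ![1, 3, 5]
    (by exact (by decide : ∀ x : Fin 6, (![2, 1, 4, 3, 0, 5] : Fin 6 → Fin 6) x = x →
        ∃ j : Fin 3, ![1, 3, 5] j = x)) ?_ ?_ (fun M hM φ => ?_ :
          ∀ M : PreDiagram 5, M.ChordFree → ∀ φ, gen M φ (tripod (D.color _ l3) (D.color _ l1)
            (D.color _ l2)) = 0))
  · intro x; fin_cases x <;> simp [D.inv_inv]
  · intro x; fin_cases x <;> simp [D.next_next_next, l1, l2, l3]
  · intro x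
    have := next_next_ne_next h₁
    have := next_next_next_ne h₁
    fin_cases x <;> simp [*]
  · intro j
    change Fin 3 at j
    fin_cases j <;> rfl
  · intro x
    fin_cases x <;> intro h <;> first | exact absurd h (by decide) | exact fun _ => rfl
  · by_cases hc : [D.color _ l3, D.color _ l1, D.color _ l2].Nodup
    · obtain ⟨d, hd⟩ := exists_nodup_append hc (by simp)
      obtain ⟨e, he⟩ := exists_nodup_append hd (by simp)
      exact gen_tripod_eq_zero hM φ he
    · apply gen_tripod_eq_zero_of_eq
      simp at hc
      tauto

/-- The component of an edge that joins two univalent vertices has degree at most one. -/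
theorem componentDegree_le_one {k : ℕ} {D : UTDiagram k} {h : D.HalfEdge}
    (hC : ∀ x, D.SameComponent h x → D.next x = x) : D.componentDegree h ≤ 1 := by
  have hsub : {x | D.SameComponent h x} ⊆ {h, D.inv h} := by
    have key : ∀ x y, D.SameComponent x y → D.SameComponent h x →
        (x ∈ ({h, D.inv h} : Set D.HalfEdge) ↔ y ∈ ({h, D.inv h} : Set D.HalfEdge)) := by
      intro x y hxy
      induction hxy with
      | rel x y hxy =>
        intro hx
        rcases hxy with rfl | rfl
        · constructor
          · rintro (rfl | rfl)
            · exact Or.inr rfl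
            · exact Or.inl (D.inv_inv _)
          · rintro (e | e)
            · exact Or.inr (by rw [Set.mem_singleton_iff, ← e, D.inv_inv])
            · exact Or.inl (D.inv.injective e)
        · rw [hC x hx]
      | refl x => exact fun _ => Iff.rfl
      | symm x y hxy ih => exact fun hx => (ih (hx.trans (SameComponent.symm hxy))).symm
      | trans x y z hxy _ ih1 ih2 => exact fun hx => (ih1 hx).trans (ih2 (hx.trans hxy))
    exact fun x hx => (key h x hx (.refl _)).1 (Or.inl rfl)
  have h1 : (D.vertexOf '' {x | D.SameComponent h x}).ncard ≤ 2 :=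
    ((Set.ncard_image_le (Set.toFinite _)).trans (Set.ncard_le_ncard hsub (Set.toFinite _))).trans
      ((Set.ncard_insert_le _ _).trans (by rw [Set.ncard_singleton]))
  unfold componentDegree
  rw [div_le_one (by norm_num)]
  exact_mod_cast h1

end UTDiagram

theorem theoremT (D : UTDiagram 5) (h : D.HalfEdge) (hC : D.componentDegree h = 2) :
    D.toSpace = 0 := by
  by_contra h0
  have := UTDiagram.componentDegree_le_one (D := D) (h := h) fun x _ => by
    by_contra hx
    exact h0 (UTDiagram.toSpace_eq_zero_of_trivalent hx)
  rw [hC] at this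
  norm_num at this
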